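/- For $n\ge 0$ let $F_n(h,\tilde h,c)$ be the level-$n$ coefficient of the four-point Virasoro conformal block with four external operators of equal weight $h$, exchanged conformal family of weight $\tilde h$, and central charge $c$. That is, $F_n=\rho_n^{T}G_n^{-1}\rho_n$, where $G_n$ is the matrix of the contravariant form on the level-$n$ descendants $L_{-k_1}\cdots L_{-k_r}|\tilde h\rangle$ ($k_1\ge\dots\ge k_r\ge1$, $\sum_i k_i=n$) and $\rho_n$ is the vector with entries $\prod_i\big(\tilde h+(k_i-1)h+\sum_{j>i}k_j\big)$. For $\tilde h=0$ (the vacuum block) the inverse is taken on the quotient by the null vectors, so that the sum runs over the conformal family of the identity. For $\alpha\in\mathbb{Q}$ and $\delta\in\mathbb{C}$ put $\tilde h=0$, $h=\delta c^{\alpha}$, and expand the coefficients in $z$ of the logarithmic vacuum block $$\dot f^{(\alpha)}(\delta,c|z)=\log\Big(1+\sum_{n\ge1}F_n(\delta c^\alpha,0,c)\,z^n\Big)\in\mathbb C(c^\alpha,c)[[z]]$$ in Puiseux series at $c=\infty$. Let $\dot f^{(\alpha)}_b(\delta|z)\in\mathbb{C}[[z]]$ denote the coefficient of $c^{b}$.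 The series $\dot f^{(1)}_1$ is the Zamolodchikov vacuum classical block, and $\dot f_0^{(M/(M+1))}$, $M\ge 1$, are the isolated coefficients. An infinite sum in $\mathbb{C}[[z]]$ means that, for each power of $z$, only finitely many summands contribute and their contributions add up to the coefficient of the sum. Then: 1. For every $\delta\in\mathbb{C}$, $$\dot f^{(1)}_1=\sum_{M=1}^{\infty}\dot f_0^{(M/(M+1))}.$$ 2. Each isolated coefficient is of order $\delta^{M+1}$: there are $a_M(z)\in\mathbb{C}[[z]]$, independent of $\delta$, such that $\dot f_0^{(M/(M+1))}(\delta|z)=\delta^{M+1}a_M(z)$ for all $M\ge1$ and all $\delta\in\mathbb{C}$. 3. Equivalently, for every choice of rational numbers $\alpha_M\in\left(\frac{M-1}{M},1\right)$, $M\ge1$, and every $\delta\in\mathbb{C}$, $$\dot f^{(1)}_1=\sum_{M=1}^{\infty}\dot f^{(\alpha_M)}_{M\alpha_M-(M-1)}.$$ Here the term with $M=1$ is zero, that is $\dot f^{(\alpha)}_{\alpha}=0$ for all rational $\alpha\in(0,1)$, and the other terms are the isolated coefficients: $\dot f^{(\alpha)}_{(M+1)\alpha-M}=\dot f_0^{(M/(M+1))}$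 for all $M\ge1$ and all rational $\alpha\in\left(\frac{M}{M+1},1\right)$. Moreover, if $M\ge1$ and $\alpha\in\left(\frac{M-1}{M},\frac{M}{M+1}\right]$ is rational, then $M\alpha-(M-1)$ is the lowest positive power of $c$ that can occur in $\dot f^{(\alpha)}$: $\dot f^{(\alpha)}_b=0$ for all rational $b$ with $0<b<M\alpha-(M-1)$. -/

import Mathlib

open scoped PowerSeries

namespace VirasoroBlock

section Block

variable {K : Type*} [Field K]

/-- The matrix element `⟨η| L_{n₁} L_{n₂} ⋯ L_{n_k} |η⟩` between a normalized Virasoro highest-weight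
vector of weight `η` and its dual, at central charge `c`, where the word is `[n₁, n₂, …, n_k]`.
The leftmost letter is removed by `⟨η| L_n = 0` for `n < 0`, `⟨η| L_0 = η ⟨η|`, and, for `n > 0`, by
moving `L_n` to the right with `[L_m, L_n] = (m - n) L_{m+n} + (c / 12) (m³ - m) δ_{m+n,0}` until it
annihilates `|η⟩`. -/
noncomputable def matrixElement (c η : K) : List ℤ → K
  | [] => 1
  | n :: w =>
    if n < 0 then 0
    else if n = 0 then η * matrixElement c η w
    else ∑ i : Fin w.length,
      (((n - w[i] : ℤ) : K) * matrixElement c η (w.set i (n + w[i])) +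
        if n + w[i] = 0 then c / 12 * ((n ^ 3 - n : ℤ) : K) * matrixElement c η (w.eraseIdx i)
        else 0)
termination_by w => w.length
decreasing_by
  all_goals simp
  grind

/-- The parts `k₁ ≥ k₂ ≥ ⋯ ≥ k_r` of a partition of `n`. It labels the level-`n` descendant
`L_{-k₁} L_{-k₂} ⋯ L_{-k_r} |η⟩`; these descendants form a basis of level `n` of the Verma module. -/
def descendant {n : ℕ} (p : n.Partition) : List ℕ :=
  p.parts.sort (· ≥ ·)

/-- The matrix of the contravariant (Shapovalov) form, `L_k† = L_{-k}`, on level `n` of the Verma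
module of weight `η` and central charge `c`. -/
noncomputable def gram (c η : K) (n : ℕ) : Matrix n.Partition n.Partition K :=
  fun p q => matrixElement c η
    ((descendant p).reverse.map (fun k => (k : ℤ)) ++ (descendant q).map (fun k => -(k : ℤ)))

/-- The ratio of three-point functions
`⟨O_h O_h L_{-k₁} ⋯ L_{-k_r} O_η⟩ / ⟨O_h O_h O_η⟩ = ∏ᵢ (η + (kᵢ - 1) h + ∑_{j > i} kⱼ)`
for two primary operators of the same weight `h`. -/
def vertex (h η : K) : List ℕ → K
  | [] => 1
  | k :: w => (η + ((k : K) - 1) * h + (w.sum : K)) * vertex h η w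

open Classical in
/-- The level-`n` coefficient `F_n(h, η, c)` of the four-point Virasoro block with four external
operators of weight `h` and exchanged conformal family of weight `η`: the inverse Shapovalov form of
the conformal family, evaluated on the vector `ρ` of three-point ratios. That is, `F_n = ρᵀ v` with
`G v = ρ`. If `G` is invertible this is `ρᵀ G⁻¹ ρ` (`blockCoeff_of_isUnit`). If `G` is degenerate
(as for `η = 0`, where `L_{-1}|0⟩` is null) and `ρ` vanishes on the null vectors, it is the inverse
of the form on the quotient by the null vectors, i.e. the sum runs over the irreducible conformal
family; since `G` is symmetric, the value does not depend on the choice of `v`. -/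
noncomputable def blockCoeff (h η c : K) (n : ℕ) : K :=
  let ρ : n.Partition → K := fun p => vertex h η (descendant p)
  if H : ∃ v : n.Partition → K, (gram c η n).mulVec v = ρ then ρ ⬝ᵥ H.choose else 0

theorem blockCoeff_of_isUnit (h η c : K) (n : ℕ) (hG : IsUnit (gram c η n).det) :
    blockCoeff h η c n = (fun p => vertex h η (descendant p)) ⬝ᵥ
      ((gram c η n)⁻¹.mulVec fun p => vertex h η (descendant p)) := by
  have H : ∃ v : n.Partition → K,
      (gram c η n).mulVec v = fun p => vertex h η (descendant p) :=
    ⟨(gram c η n)⁻¹.mulVec fun p => vertex h η (descendant p), by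
      rw [Matrix.mulVec_mulVec, Matrix.mul_nonsing_inv _ hG, Matrix.one_mulVec]⟩
  have hv := H.choose_spec
  unfold blockCoeff
  simp only [dif_pos H]
  congr 1
  conv_rhs => rw [← hv]
  rw [Matrix.mulVec_mulVec, Matrix.nonsing_inv_mul _ hG, Matrix.one_mulVec]

/-- The Virasoro conformal block `F(h, η, c | z) = 1 + F_1 z + F_2 z² + ⋯`. -/
noncomputable def block (h η c : K) : K⟦X⟧ :=
  PowerSeries.mk (blockCoeff h η c)

/-- The logarithmic conformal block `f = log F`. -/
noncomputable def logBlock [Algebra ℚ K] (h η c : K) : K⟦X⟧ :=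
  PowerSeries.logOf (block h η c)

end Block

/-- Generalized Puiseux series at `c = ∞` with complex coefficients and rational exponents. The Hahn
variable is `c⁻¹`, so the coefficient of `c ^ b` sits at exponent `-b`. -/
abbrev PuiseuxAtInfty : Type := HahnSeries ℚ ℂ

/-- The power `c ^ b` of the central charge. -/
noncomputable def cPow (b : ℚ) : PuiseuxAtInfty :=
  HahnSeries.single (-b) 1

/-- The `α`-heavy logarithmic vacuum block: exchanged weight `0`, external weights
`h = δ c ^ α`, each coefficient in `z` being expanded in powers of `c` near `c = ∞`. -/
noncomputable def heavyVacuumLogBlock (α : ℚ) (δ : ℂ) : PuiseuxAtInfty⟦X⟧ :=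
  logBlock (HahnSeries.C δ * cPow α) 0 (cPow 1)

/-- The coefficient of `c ^ b` in the `α`-heavy logarithmic vacuum block, a power series in `z`. For
`b ≥ 0` these are the coefficients of the `α`-heavy classical vacuum block. -/
noncomputable def vacuumCoeff (α b : ℚ) (δ : ℂ) : ℂ⟦X⟧ :=
  PowerSeries.mk fun n => (PowerSeries.coeff n (heavyVacuumLogBlock α δ)).coeff (-b)

/-- The Zamolodchikov classical vacuum block: the coefficient of `c` for `h = δ c`. -/
noncomputable def zamolodchikovVacuum (δ : ℂ) : ℂ⟦X⟧ :=
  vacuumCoeff 1 1 δ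

/-- The isolated coefficient: the coefficient of `c ^ 0` at the exceptional point
`α = M / (M + 1)`. -/
noncomputable def isolatedCoeff (M : ℕ) (δ : ℂ) : ℂ⟦X⟧ :=
  vacuumCoeff ((M : ℚ) / (M + 1)) 0 δ

/-- The coefficient of `c ^ (M α - (M - 1))` in the `α`-heavy classical vacuum block. -/
noncomputable def regularCoeff (M : ℕ) (α : ℚ) (δ : ℂ) : ℂ⟦X⟧ :=
  vacuumCoeff α (M * α - (M - 1)) δ

/-- The formal power series `f` is the sum of the family `u`, coefficient by coefficient in `z`: for
each power of `z` only finitely many terms contribute, and their sum is the coefficient of `f`. -/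
def IsFormalSum {ι : Type*} (u : ι → ℂ⟦X⟧) (f : ℂ⟦X⟧) : Prop :=
  ∀ n : ℕ, (Function.support fun i => PowerSeries.coeff n (u i)).Finite ∧
    PowerSeries.coeff n f = ∑ᶠ i, PowerSeries.coeff n (u i)

end VirasoroBlock

open VirasoroBlock

/-! The theorem is exponent counting on top of exponentiation of the vacuum block: each coefficient
in `z` of `log F(h, 0, c)` is a polynomial in `h` whose coefficient of `h ^ k` vanishes for `k < 2`
and otherwise is a series in `c⁻¹` of order at least `k - 1` (`logCoeff_ne_zero`). For `h = δ c ^ α`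
only powers `c ^ (k α - j)` with integers `k ≥ 2` and `j ≥ k - 1` occur. At `α = 1` the power `c ^
1` collects `j = k - 1` for all `k`. At `α = M / (M + 1)` the power `c ^ 0` forces `j = k - 1` and
`k = M + 1`, which leaves one of those terms.

Exponentiation comes from a free field with background charge. Put `c = 1 - 24 μ` and `4 μ ν = 1`.
The Virasoro algebra acts on polynomials in `y_1, y_2, …` with vacuum `1`, and vacuum matrix
elements are constant terms. Setting every `y_n = s` turns `L_{-k}` on level `N` into the factor `(k
- 1) h + N` with `h = μ (s² + 2 s)` (`eval_fockVir`), so on descendants evaluation is the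
three-point vector `ρ`. Words in the positive modes separate all polynomials
(`det_fockPairing_ne_zero`), so evaluation is represented by combinations of descendants `W_N`,
which satisfy the Ward identities `L_k W_{N+k} = ((k - 1) h + N) W_N`; and `F_N` is `W_N` evaluated
at `s`.

For `k > 0` the operator `L_k` is a differential operator whose second-order part carries the factor
`ν`. Hence `log W` solves Hamilton–Jacobi equations (`IsWhittaker.hamiltonJacobi`), and solving them
level by level shows that `4 ν log W` contains no positive power of `c` when `s` is an independent
variable (`IsWhittaker.smul_log_mem`). So `log F` is `μ` times an integral polynomial in `ε = s² + 2
s = 4 ν h`, and `h ^ k` comes with `μ (4 ν) ^ k`, of order `c ^ (1 - k)`. The terms `k = 0, 1`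
vanish since `F_N` is quadratic in `ρ`, which is divisible by `h` for `N > 0`. -/

namespace VirasoroBlock

/-! ### Free-field realization: modes and their commutators. -/

section Fock

open MvPolynomial

variable {R : Type*} [CommRing R]

/-- The creation variable `y_n` of the Fock space, with `y_n = 0` for `n ≤ 0`. -/
noncomputable def fockVar (R : Type*) [CommRing R] (n : ℤ) : MvPolynomial ℕ R :=
  if 0 < n then X (n.toNat - 1) else 0

/-- The derivative with respect to `y_n`, which is zero for `n ≤ 0`. -/
noncomputable def fockDeriv (R : Type*) [CommRing R] (n : ℤ) :
    Derivation R (MvPolynomial ℕ R) (MvPolynomial ℕ R) :=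
  if 0 < n then pderiv (n.toNat - 1) else 0

/-- The derivation of the Fock space with `y_i ↦ i y_{i-n}`. -/
noncomputable def fockShift (R : Type*) [CommRing R] (n : ℤ) :
    Derivation R (MvPolynomial ℕ R) (MvPolynomial ℕ R) :=
  mkDerivation R fun i => ((i : R) + 1) • fockVar R (i + 1 - n)

theorem fockVar_of_nonpos {n : ℤ} (hn : n ≤ 0) : fockVar R n = 0 := if_neg hn.not_gt

theorem fockDeriv_of_nonpos {n : ℤ} (hn : n ≤ 0) : fockDeriv R n = 0 := if_neg hn.not_gt

theorem fockVar_natCast_add_one (i : ℕ) : fockVar R (i + 1) = X i := by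
  rw [fockVar, if_pos (by positivity)]
  congr 1

theorem fockDeriv_natCast_add_one (i : ℕ) : fockDeriv R (i + 1) = pderiv i := by
  rw [fockDeriv, if_pos (by positivity)]
  congr 1

theorem exists_natCast_add_one {k : ℤ} (hk : 0 < k) : ∃ i : ℕ, k = i + 1 :=
  ⟨(k - 1).toNat, by omega⟩

theorem fockDeriv_fockVar {k : ℤ} (hk : 0 < k) (l : ℤ) :
    fockDeriv R k (fockVar R l) = if k = l then 1 else 0 := by
  obtain ⟨i, rfl⟩ := exists_natCast_add_one hk
  rcases le_or_gt l 0 with hl | hl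
  · rw [fockVar_of_nonpos hl, map_zero, if_neg (by omega)]
  · obtain ⟨j, rfl⟩ := exists_natCast_add_one hl
    rw [fockVar_natCast_add_one, fockDeriv_natCast_add_one, pderiv_X, Pi.single_apply]
    simp [eq_comm]

theorem fockDeriv_comm (k l : ℤ) (p : MvPolynomial ℕ R) :
    fockDeriv R k (fockDeriv R l p) = fockDeriv R l (fockDeriv R k p) := by
  have : ⁅fockDeriv R k, fockDeriv R l⁆ = 0 := by
    refine derivation_ext fun i => ?_
    rw [Derivation.commutator_apply, ← fockVar_natCast_add_one]
    rcases le_or_gt k 0 with hk | hk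
    · simp [fockDeriv_of_nonpos hk]
    rcases le_or_gt l 0 with hl | hl
    · simp [fockDeriv_of_nonpos hl]
    rw [fockDeriv_fockVar hk, fockDeriv_fockVar hl]
    split_ifs <;> simp
  have h := congrArg (fun d => d p) this
  simpa [Derivation.commutator_apply, sub_eq_zero] using h

theorem fockShift_fockVar (n : ℤ) {k : ℤ} (hk : 0 < k) :
    fockShift R n (fockVar R k) = (k : R) • fockVar R (k - n) := by
  obtain ⟨i, rfl⟩ := exists_natCast_add_one hk
  rw [fockVar_natCast_add_one, fockShift, mkDerivation_X]
  push_cast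
  rfl

theorem fockDeriv_fockShift {k : ℤ} (hk : 0 < k) (n : ℤ) (p : MvPolynomial ℕ R) :
    fockDeriv R k (fockShift R n p) =
      fockShift R n (fockDeriv R k p) + ((n + k : ℤ) : R) • fockDeriv R (n + k) p := by
  have : ⁅fockDeriv R k, fockShift R n⁆ = ((n + k : ℤ) : R) • fockDeriv R (n + k) := by
    refine derivation_ext fun i => ?_
    rw [Derivation.commutator_apply, Derivation.smul_apply, ← fockVar_natCast_add_one,
      fockShift_fockVar n (by positivity), Derivation.map_smul, fockDeriv_fockVar hk, fockDeriv_fockVar hk]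
    rcases le_or_gt (n + k) 0 with hl | hl
    · rw [fockDeriv_of_nonpos hl, if_neg (by omega)]
      split_ifs <;> simp
    · rw [fockDeriv_fockVar hl]
      have e : k = i + 1 - n ↔ n + k = i + 1 := by omega
      simp only [e]
      have h0 : fockShift R n (if k = i + 1 then 1 else 0) = 0 := by split_ifs <;> simp
      rw [h0]
      split_ifs with h
      · simp [h]
      · simp
  have h := congrArg (fun d => d p) this
  rw [← sub_eq_iff_eq_add']
  simpa [Derivation.commutator_apply] using h

/-- The Virasoro generator `L_n` on the Fock space. It has central charge `1 - 24 μ` if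
`4 μ ν = 1`. -/
noncomputable def fockVir (μ ν : R) (n : ℤ) : MvPolynomial ℕ R →ₗ[R] MvPolynomial ℕ R :=
  (fockShift R n).toLinearMap
    + ν • ∑ i ∈ Finset.Ioo 0 n, ((i * (n - i) : ℤ) : R) •
        (fockDeriv R i).toLinearMap ∘ₗ (fockDeriv R (n - i)).toLinearMap
    - ((n * (n + 1) : ℤ) : R) • (fockDeriv R n).toLinearMap
    + μ • ∑ i ∈ Finset.Ioo 0 (-n), LinearMap.mulLeft R (fockVar R i * fockVar R (-n - i))
    + (2 * μ * ((-n - 1 : ℤ) : R)) • LinearMap.mulLeft R (fockVar R (-n))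

theorem fockVir_apply (μ ν : R) (n : ℤ) (p : MvPolynomial ℕ R) :
    fockVir μ ν n p = fockShift R n p
      + ν • ∑ i ∈ Finset.Ioo 0 n, ((i * (n - i) : ℤ) : R) • fockDeriv R i (fockDeriv R (n - i) p)
      - ((n * (n + 1) : ℤ) : R) • fockDeriv R n p
      + μ • ∑ i ∈ Finset.Ioo 0 (-n), fockVar R i * fockVar R (-n - i) * p
      + (2 * μ * ((-n - 1 : ℤ) : R)) • (fockVar R (-n) * p) := by
  simp [fockVir, mul_assoc]

theorem fockDeriv_fockVir (μ ν : R) {k : ℤ} (hk : 0 < k) (n : ℤ) (p : MvPolynomial ℕ R) :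
    fockDeriv R k (fockVir μ ν n p) = fockVir μ ν n (fockDeriv R k p)
      + ((n + k : ℤ) : R) • fockDeriv R (n + k) p + (2 * μ) • (fockVar R (-n - k) * p)
      + if n + k = 0 then (2 * μ * ((-n - 1 : ℤ) : R)) • p else 0 := by
  have h1 : fockDeriv R k (∑ i ∈ Finset.Ioo 0 (-n), fockVar R i * fockVar R (-n - i) * p) =
      ∑ i ∈ Finset.Ioo 0 (-n), fockVar R i * fockVar R (-n - i) * fockDeriv R k p
        + (2 : R) • (fockVar R (-n - k) * p) := by
    -- The derivative can hit either factor, at `i = k` or at `i = -n - k`. The two hits give the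
    -- same term, and both indices lie in the range exactly when `-n - k` is positive.
    have h2 : ∀ i, fockDeriv R k (fockVar R i * fockVar R (-n - i) * p) =
        fockVar R i * fockVar R (-n - i) * fockDeriv R k p
          + ((if -n - k = i then fockVar R (-n - k) * p else 0)
            + if k = i then fockVar R (-n - k) * p else 0) := by
      intro i
      rw [Derivation.leibniz, Derivation.leibniz, fockDeriv_fockVar hk, fockDeriv_fockVar hk,
        smul_eq_mul, smul_eq_mul, smul_eq_mul, smul_eq_mul]
      have e : (-n - k = i) ↔ (k = -n - i) := by omega
      simp only [e]
      split_ifs with h3 h4 h4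
      · rw [← h3, ← h4, show -n - k = k by omega]; ring
      · rw [show -n - k = i by omega]; ring
      · rw [← h4]; ring
      · ring
    rw [map_sum, Finset.sum_congr rfl fun i _ => h2 i, Finset.sum_add_distrib,
      Finset.sum_add_distrib, Finset.sum_ite_eq, Finset.sum_ite_eq]
    congr 1
    by_cases h : k < -n
    · rw [if_pos (by simp; omega), if_pos (by simp; omega), two_smul]
    · rw [if_neg (by simp; omega), if_neg (by simp; omega), fockVar_of_nonpos (by omega)]
      simp
  have h3 : ∀ i, fockDeriv R k (fockDeriv R i (fockDeriv R (n - i) p)) =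
      fockDeriv R i (fockDeriv R (n - i) (fockDeriv R k p)) := by
    intro i
    rw [fockDeriv_comm k i, fockDeriv_comm k (n - i)]
  have h4 : fockDeriv R k (fockVar R (-n) * p) = fockVar R (-n) * fockDeriv R k p
      + if n + k = 0 then p else 0 := by
    rw [Derivation.leibniz, fockDeriv_fockVar hk, smul_eq_mul, smul_eq_mul]
    have e : k = -n ↔ n + k = 0 := by omega
    simp only [e]
    split_ifs <;> simp
  rw [fockVir_apply, fockVir_apply]
  simp only [map_add, map_sub, Derivation.map_smul, h1, h4, fockDeriv_fockShift hk, fockDeriv_comm k n]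
  simp only [map_sum, Derivation.map_smul, h3]
  split_ifs <;> simp only [smul_add, smul_smul, smul_zero, mul_comm μ 2] <;> abel

theorem fockVir_fockVar_mul (μ ν : R) {k : ℤ} (hk : 0 < k) (n : ℤ) (p : MvPolynomial ℕ R) :
    fockVir μ ν n (fockVar R k * p) = fockVar R k * fockVir μ ν n p
      + (k : R) • (fockVar R (k - n) * p)
      + (2 * ν * ((k * (n - k) : ℤ) : R)) • fockDeriv R (n - k) p
      - if n = k then ((n * (n + 1) : ℤ) : R) • p else 0 := by
  have h1 : ∑ i ∈ Finset.Ioo 0 n, ((i * (n - i) : ℤ) : R) •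
        fockDeriv R i (fockDeriv R (n - i) (fockVar R k * p)) =
      fockVar R k * ∑ i ∈ Finset.Ioo 0 n, ((i * (n - i) : ℤ) : R) •
        fockDeriv R i (fockDeriv R (n - i) p)
      + (2 * ((k * (n - k) : ℤ) : R)) • fockDeriv R (n - k) p := by
    have h2 : ∀ i ∈ Finset.Ioo 0 n, ((i * (n - i) : ℤ) : R) •
        fockDeriv R i (fockDeriv R (n - i) (fockVar R k * p)) =
        fockVar R k * ((i * (n - i) : ℤ) : R) • fockDeriv R i (fockDeriv R (n - i) p)
        + ((if k = i then ((k * (n - k) : ℤ) : R) • fockDeriv R (n - k) p else 0)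
          + if n - k = i then ((k * (n - k) : ℤ) : R) • fockDeriv R (n - k) p else 0) := by
      intro i hi
      rw [Finset.mem_Ioo] at hi
      have e : (n - k = i) ↔ (n - i = k) := by omega
      have e' : (k = i) ↔ (i = k) := eq_comm
      rw [Derivation.leibniz, fockDeriv_fockVar (by omega), map_add, smul_eq_mul, smul_eq_mul,
        Derivation.leibniz, fockDeriv_fockVar (by omega), smul_eq_mul, smul_eq_mul]
      simp only [e, e']
      split_ifs with h3 h4 h4
      · subst h3
        rw [h4]
        simp [smul_add, add_assoc]
      · subst h3
        simp [smul_add]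
      · rw [h4]
        have h5 : n - k = i := by omega
        rw [h5]
        simp [smul_add, mul_comm i k]
      · simp
    rw [Finset.sum_congr rfl h2, Finset.sum_add_distrib, Finset.sum_add_distrib, Finset.sum_ite_eq,
      Finset.sum_ite_eq, Finset.mul_sum]
    congr 1
    by_cases h : k < n
    · rw [if_pos (by simp; omega), if_pos (by simp; omega), ← two_smul R, smul_smul]
    · rw [if_neg (by simp; omega), if_neg (by simp; omega), fockDeriv_of_nonpos (by omega)]
      simp
  have h4 : ((n * (n + 1) : ℤ) : R) • fockDeriv R n (fockVar R k * p) =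
      fockVar R k * ((n * (n + 1) : ℤ) : R) • fockDeriv R n p
      + if n = k then ((n * (n + 1) : ℤ) : R) • p else 0 := by
    rcases le_or_gt n 0 with hn | hn
    · rw [fockDeriv_of_nonpos hn, if_neg (by omega)]; simp
    · rw [Derivation.leibniz, fockDeriv_fockVar hn, smul_eq_mul, smul_eq_mul]
      split_ifs <;> simp [smul_add]
  rw [fockVir_apply, fockVir_apply, h1, h4, Derivation.leibniz, fockShift_fockVar n hk]
  have h5 : ∑ i ∈ Finset.Ioo 0 (-n), fockVar R i * fockVar R (-n - i) * (fockVar R k * p) =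
      fockVar R k * ∑ i ∈ Finset.Ioo 0 (-n), fockVar R i * fockVar R (-n - i) * p := by
    rw [Finset.mul_sum]
    exact Finset.sum_congr rfl fun i _ => by ring
  rw [h5]
  simp only [smul_eq_mul, MvPolynomial.smul_eq_C_mul, map_mul, map_ofNat, map_sub, map_add,
    map_one, Int.cast_mul, Int.cast_add, Int.cast_sub, Int.cast_one]
  ring

/-- The oscillator mode `a_k`. -/
noncomputable def fockOsc (μ : R) (k : ℤ) : MvPolynomial ℕ R →ₗ[R] MvPolynomial ℕ R :=
  (k : R) • (fockDeriv R k).toLinearMap + (2 * μ) • LinearMap.mulLeft R (fockVar R (-k))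

theorem fockOsc_apply (μ : R) (k : ℤ) (p : MvPolynomial ℕ R) :
    fockOsc μ k p = (k : R) • fockDeriv R k p + (2 * μ) • (fockVar R (-k) * p) := rfl

/-- The mode `a_k` is a derivative for `k > 0` and a multiplication for `k < 0`, so this unites
`fockDeriv_fockVir` and `fockVir_fockVar_mul`; `4 μ ν = 1` makes the coefficients match. The scalar
is the anomaly due to the background charge. -/
theorem fockOsc_fockVir {μ ν : R} (h : 4 * μ * ν = 1) (k n : ℤ) (p : MvPolynomial ℕ R) :
    fockOsc μ k (fockVir μ ν n p) = fockVir μ ν n (fockOsc μ k p) + (k : R) • fockOsc μ (k + n) p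
      - if k + n = 0 then (2 * μ * ((k * (n + 1) : ℤ) : R)) • p else 0 := by
  have hC : 4 * (C μ : MvPolynomial ℕ R) * C ν = 1 := by
    rw [← map_ofNat C 4, ← map_mul, ← map_mul, h, map_one]
  simp only [fockOsc_apply]
  rcases lt_trichotomy k 0 with hk | rfl | hk
  · have := fockVir_fockVar_mul μ ν (neg_pos.2 hk) n p
    rw [fockDeriv_of_nonpos hk.le, map_add, map_smul, map_smul, this,
      show -(k + n) = -k - n by ring, show n - -k = k + n by ring]
    have e : n = -k ↔ k + n = 0 := by omega
    simp only [e]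
    split_ifs with h0
    · obtain rfl : k = -n := by omega
      simp only [MvPolynomial.smul_eq_C_mul, map_mul, map_ofNat, map_add,
        map_one, map_neg, Int.cast_mul, Int.cast_add, Int.cast_one, Int.cast_neg,
        Derivation.coe_zero, Pi.zero_apply, mul_zero, map_zero, neg_neg, sub_self, neg_add_cancel,
        fockVar_of_nonpos le_rfl, fockDeriv_of_nonpos le_rfl]
      ring
    · simp only [MvPolynomial.smul_eq_C_mul, map_mul, map_ofNat, map_add,
        map_neg, Int.cast_mul, Int.cast_add, Int.cast_neg,
        Derivation.coe_zero, Pi.zero_apply, mul_zero, map_zero]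
      linear_combination (-(C (k : R)) * (C (k : R) + C (n : R)) * fockDeriv R (k + n) p) * (-1) * hC
  · simp [fockDeriv_of_nonpos, fockVar_of_nonpos]
  · rw [fockDeriv_fockVir μ ν hk, fockVar_of_nonpos (show -k ≤ 0 by omega), map_add, map_smul,
      map_smul, show -(k + n) = -n - k by ring, add_comm n k]
    split_ifs with h0
    · obtain rfl : k = -n := by omega
      simp only [MvPolynomial.smul_eq_C_mul, map_mul, map_ofNat, map_sub, map_add,
        map_one, map_neg, Int.cast_mul, Int.cast_add, Int.cast_sub, Int.cast_one, Int.cast_neg,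
        zero_mul, mul_zero, map_zero]
      ring
    · simp only [MvPolynomial.smul_eq_C_mul, map_mul, map_ofNat, map_add,
        Int.cast_add,
        zero_mul, mul_zero, map_zero]
      ring

end Fock
-- The Virasoro relations on the Fock space.
section Fock

open MvPolynomial

variable {R : Type*} [CommRing R]

theorem constantCoeff_fockVar (n : ℤ) : constantCoeff (fockVar R n) = 0 := by
  unfold fockVar
  split_ifs <;> simp

theorem constantCoeff_fockShift (n : ℤ) (p : MvPolynomial ℕ R) :
    constantCoeff (fockShift R n p) = 0 := by
  induction p using MvPolynomial.induction_on with
  | C a => simp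
  | add p q hp hq => rw [map_add, map_add, hp, hq, add_zero]
  | mul_X p i hp =>
    rw [Derivation.leibniz, fockShift, mkDerivation_X]
    simp [constantCoeff_fockVar]

theorem fockVir_one {n : ℤ} (hn : 0 ≤ n) (μ ν : R) : fockVir μ ν n 1 = 0 := by
  rw [fockVir_apply, fockVar_of_nonpos (neg_nonpos.2 hn), Finset.Ioo_eq_empty (b := -n) (by omega)]
  simp

theorem constantCoeff_fockVir {n : ℤ} (hn : n ≤ 0) (μ ν : R) (p : MvPolynomial ℕ R) :
    constantCoeff (fockVir μ ν n p) = 0 := by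
  rw [fockVir_apply, fockDeriv_of_nonpos hn, Finset.Ioo_eq_empty (b := n) (by omega)]
  simp [constantCoeff_fockShift, constantCoeff_fockVar, smul_eq_C_mul]

theorem isUnit_intCast [Algebra ℚ R] {k : ℤ} (hk : k ≠ 0) : IsUnit (k : R) := by
  have := (IsUnit.mk0 (k : ℚ) (by exact_mod_cast hk)).map (algebraMap ℚ R)
  rwa [map_intCast] at this

theorem eq_C_of_fockDeriv_eq_zero [Algebra ℚ R] {p : MvPolynomial ℕ R}
    (hp : ∀ k : ℤ, 0 < k → fockDeriv R k p = 0) : p = C (constantCoeff p) := by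
  ext m
  rw [coeff_C]
  split_ifs with hm
  · rw [← hm, constantCoeff_eq]
  · obtain ⟨i, hi⟩ : ∃ i, m i ≠ 0 := by
      by_contra! h
      exact hm (Finsupp.ext fun i => (h i).symm)
    have h := hp (i + 1) (by positivity)
    rw [fockDeriv_natCast_add_one] at h
    have h2 := coeff_pderiv (i := i) p (m - Finsupp.single i 1)
    have h3 : m - Finsupp.single i 1 + Finsupp.single i 1 = m :=
      tsub_add_cancel_of_le (by rw [Finsupp.single_le_iff]; omega)
    rw [h, h3, coeff_zero] at h2
    have h4 : IsUnit ((((m - Finsupp.single i 1 : ℕ →₀ ℕ) i + 1 : ℕ) : ℤ) : R) :=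
      isUnit_intCast (by positivity)
    push_cast at h4
    exact h4.mul_left_eq_zero.1 h2.symm

/-- Schur's lemma for the oscillators: `T 1` is killed by all derivatives, hence constant, and `T`
commutes with multiplication by the variables because `2 μ` is invertible with inverse `2 ν`. -/
theorem eq_smul_of_comm_fockOsc [Algebra ℚ R] {μ ν : R} (h : 4 * μ * ν = 1)
    (T : MvPolynomial ℕ R →ₗ[R] MvPolynomial ℕ R)
    (hT : ∀ k p, fockOsc μ k (T p) = T (fockOsc μ k p)) (p : MvPolynomial ℕ R) :
    T p = constantCoeff (T 1) • p := by
  have hY : ∀ k : ℤ, 0 < k → ∀ p, T (fockVar R k * p) = fockVar R k * T p := by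
    intro k hk p
    have h1 := hT (-k) p
    simp only [fockOsc_apply, fockDeriv_of_nonpos (neg_nonpos.2 hk.le), neg_neg,
      Derivation.coe_zero, Pi.zero_apply, smul_zero, zero_add, map_smul] at h1
    have h2 := congrArg (fun q => (2 * ν) • q) h1
    simp only [smul_smul] at h2
    rw [show 2 * ν * (2 * μ) = 1 by linear_combination h, one_smul, one_smul] at h2
    exact h2.symm
  have h1 : T 1 = C (constantCoeff (T 1)) := by
    refine eq_C_of_fockDeriv_eq_zero fun k hk => ?_
    have h1 := hT k 1
    simp only [fockOsc_apply, fockVar_of_nonpos (neg_nonpos.2 hk.le), Derivation.map_one_eq_zero,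
      smul_zero, zero_mul, add_zero, map_zero] at h1
    exact (isUnit_intCast hk.ne').smul_eq_zero.1 h1
  induction p using MvPolynomial.induction_on with
  | C a =>
    rw [show (C a : MvPolynomial ℕ R) = a • 1 by rw [smul_eq_C_mul, mul_one], map_smul,
      smul_comm]
    congr 1
    conv_lhs => rw [h1]
    rw [smul_eq_C_mul, mul_one]
  | add p q hp hq => rw [map_add, hp, hq, smul_add]
  | mul_X p i hp =>
    rw [mul_comm, ← fockVar_natCast_add_one, hY _ (by positivity), hp, mul_smul_comm]

theorem constantCoeff_fockVir_fockVar {μ ν : R} {k : ℤ} (hk : 0 < k) (n : ℤ) :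
    constantCoeff (fockVir μ ν n (fockVar R k)) =
      - if n = k then ((n * (n + 1) : ℤ) : R) else 0 := by
  rcases le_or_gt n 0 with hn | hn
  · rw [constantCoeff_fockVir hn, if_neg (by omega), neg_zero]
  have := fockVir_fockVar_mul μ ν hk n 1
  rw [mul_one, fockVir_one hn.le] at this
  rw [this]
  split_ifs <;> simp [constantCoeff_fockVar, smul_eq_C_mul]

theorem constantCoeff_fockVir_fockVar_mul {μ ν : R} {k l : ℤ} (hk : 0 < k) (hl : 0 < l) (n : ℤ) :
    constantCoeff (fockVir μ ν n (fockVar R k * fockVar R l)) =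
      if n = k + l then 2 * ν * ((k * l : ℤ) : R) else 0 := by
  rw [fockVir_fockVar_mul μ ν hk]
  rcases le_or_gt (n - k) 0 with h | h
  · rw [fockDeriv_of_nonpos h, if_neg (show ¬ n = k + l by omega)]
    split_ifs <;> simp [constantCoeff_fockVar, smul_eq_C_mul]
  · rw [fockDeriv_fockVar h, if_neg (show ¬ n = k by omega)]
    have e : n - k = l ↔ n = k + l := by omega
    simp only [e]
    split_ifs with h2
    · rw [h2, add_sub_cancel_left]
      simp [constantCoeff_fockVar, smul_eq_C_mul]
    · simp [constantCoeff_fockVar, smul_eq_C_mul]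

theorem six_mul_sum_Ioo_mul_sub {l : ℤ} (hl : 0 < l) :
    6 * ∑ i ∈ Finset.Ioo 0 l, i * (l - i) = l ^ 3 - l := by
  have key : ∀ (m : ℕ) (a : ℤ), 6 * ∑ i ∈ Finset.Ioo (0 : ℤ) (m + 1), i * (a - i) =
      3 * a * m * (m + 1) - m * (m + 1) * (2 * m + 1) := by
    intro m a
    induction m with
    | zero =>
      have : Finset.Ioo (0 : ℤ) 1 = ∅ := by decide
      simp [this]
    | succ m ih =>
      have : Finset.Ioo (0 : ℤ) ((m + 1 : ℕ) + 1) = insert (m + 1 : ℤ) (Finset.Ioo (0 : ℤ) (m + 1)) := by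
        ext x
        simp only [Finset.mem_Ioo, Finset.mem_insert]
        omega
      rw [this, Finset.sum_insert (by simp), mul_add, ih]
      push_cast
      ring
  obtain ⟨m, rfl⟩ := exists_natCast_add_one hl
  rw [key]
  ring

/-- The quadratic part of `L_n 1` contributes the central charge `1` of a free boson, through `∑ i
(m - i) = (m³ - m) / 6`; the linear part contributes the `-24 μ` of the background charge. -/
theorem constantCoeff_fockVir_fockVir_one {μ ν κ : R} (h : 4 * μ * ν = 1)
    (hκ : 12 * κ = 1 - 24 * μ) [Algebra ℚ R] {m n : ℤ} (hm : 0 < m) (hn : n < 0) :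
    constantCoeff (fockVir μ ν m (fockVir μ ν n 1)) =
      if m + n = 0 then κ * ((m ^ 3 - m : ℤ) : R) else 0 := by
  have h1 : fockVir μ ν n 1 = μ • ∑ i ∈ Finset.Ioo 0 (-n), fockVar R i * fockVar R (-n - i)
      + (2 * μ * ((-n - 1 : ℤ) : R)) • fockVar R (-n) := by
    rw [fockVir_apply, fockDeriv_of_nonpos hn.le, Finset.Ioo_eq_empty (b := n) (by omega)]
    simp
  have h2 : ∀ i ∈ Finset.Ioo 0 (-n), constantCoeff (fockVir μ ν m
      (fockVar R i * fockVar R (-n - i))) =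
      if m + n = 0 then 2 * ν * ((i * (m - i) : ℤ) : R) else 0 := by
    intro i hi
    rw [Finset.mem_Ioo] at hi
    rw [constantCoeff_fockVir_fockVar_mul hi.1 (by omega)]
    have e : m = i + (-n - i) ↔ m + n = 0 := by omega
    simp only [e]
    split_ifs with h0
    · rw [show m = -n by omega]
    · rfl
  have e : m = -n ↔ m + n = 0 := by omega
  rw [h1, map_add, map_smul, map_smul, map_sum, map_add, smul_eq_C_mul, smul_eq_C_mul, map_mul,
    map_mul, map_sum, Finset.sum_congr rfl h2, constantCoeff_fockVir_fockVar (by omega),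
    constantCoeff_C, constantCoeff_C]
  simp only [e]
  split_ifs with h0
  · obtain rfl : n = -m := by omega
    rw [neg_neg, ← Finset.mul_sum, ← Int.cast_sum]
    have h6 : (6 : R) * ((∑ i ∈ Finset.Ioo 0 m, i * (m - i) : ℤ) : R) = (m : R) ^ 3 - m := by
      have := congrArg (Int.cast (R := R)) (six_mul_sum_Ioo_mul_sub hm)
      push_cast at this ⊢
      exact this
    have h12 : IsUnit (((12 : ℤ)) : R) := isUnit_intCast (by norm_num)
    refine h12.mul_left_cancel ?_
    push_cast at h6 ⊢
    linear_combination (4 * μ * ν) * h6 + ((m : R) ^ 3 - m) * h - ((m : R) ^ 3 - m) * hκ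
  · simp

/-- The Virasoro relations on the Fock space. -/
theorem fockVir_commutator [Algebra ℚ R] {μ ν κ : R} (h : 4 * μ * ν = 1)
    (hκ : 12 * κ = 1 - 24 * μ) (m n : ℤ) (p : MvPolynomial ℕ R) :
    fockVir μ ν m (fockVir μ ν n p) = fockVir μ ν n (fockVir μ ν m p)
      + ((m - n : ℤ) : R) • fockVir μ ν (m + n) p
      + if m + n = 0 then (κ * ((m ^ 3 - m : ℤ) : R)) • p else 0 := by
  -- `T` is the failure of the relation without central term. It commutes with every oscillator, so
  -- it is a scalar, which is read off on the vacuum.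
  let T : MvPolynomial ℕ R →ₗ[R] MvPolynomial ℕ R :=
    fockVir μ ν m ∘ₗ fockVir μ ν n - fockVir μ ν n ∘ₗ fockVir μ ν m
      - ((m - n : ℤ) : R) • fockVir μ ν (m + n)
  have hT : ∀ p, T p = fockVir μ ν m (fockVir μ ν n p) - fockVir μ ν n (fockVir μ ν m p)
      - ((m - n : ℤ) : R) • fockVir μ ν (m + n) p := fun p => by simp [T]
  have hcomm : ∀ k p, fockOsc μ k (T p) = T (fockOsc μ k p) := by
    intro k p
    have e1 : k + m + n = 0 ↔ k + n + m = 0 := by rw [add_right_comm]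
    have e2 : k + (m + n) = 0 ↔ k + n + m = 0 := by rw [← e1, add_assoc]
    simp only [hT, map_sub, map_smul, fockOsc_fockVir h, map_add, apply_ite (fockVir μ ν m),
      apply_ite (fockVir μ ν n), map_zero, e1, e2]
    rw [show k + m + n = k + (m + n) by ring]
    simp only [smul_eq_C_mul]
    by_cases h0 : k + (m + n) = 0
    -- The anomalies of the two orders of `L_m` and `L_n` and of `L_{m+n}` cancel only on the
    -- resonance `k = -(m + n)`, the one case in which they appear.
    · have hz : C (σ := ℕ) (k : R) = -(C (m : R) + C (n : R)) := by
        rw [show k = -(m + n) by omega]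
        simp [add_comm]
      rw [show k + n + m = k + (m + n) by ring, if_pos h0, if_pos h0, if_pos h0]
      split_ifs <;> simp only [map_mul, map_ofNat, map_sub, map_add, map_one, Int.cast_mul,
        Int.cast_add, Int.cast_sub, Int.cast_one] <;>
        linear_combination (2 * C (k : R) * C μ * (C (m : R) - C (n : R)) * p) * hz
    · rw [show k + n + m = k + (m + n) by ring, if_neg h0, if_neg h0, if_neg h0]
      split_ifs <;> simp only [map_mul, map_ofNat, map_sub, map_add, map_one, Int.cast_mul,
        Int.cast_add, Int.cast_sub, Int.cast_one] <;> ring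
  have hc : constantCoeff (T 1) = if m + n = 0 then κ * ((m ^ 3 - m : ℤ) : R) else 0 := by
    have h0 : constantCoeff (fockVir μ ν (m + n) 1) = 0 := by
      rcases le_total (m + n) 0 with h | h
      · exact constantCoeff_fockVir h _ _ _
      · rw [fockVir_one h, map_zero]
    rw [hT, map_sub, map_sub, smul_eq_C_mul, map_mul, h0, mul_zero, sub_zero]
    rcases le_or_gt m 0 with hm | hm
    · rw [constantCoeff_fockVir hm]
      rcases le_or_gt n 0 with hn | hn
      · rw [constantCoeff_fockVir hn]
        split_ifs
        · obtain rfl : m = 0 := by omega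
          simp
        · simp
      · rw [zero_sub]
        rcases hm.eq_or_lt with rfl | hm
        · simp [fockVir_one, hn.ne']
        · rw [constantCoeff_fockVir_fockVir_one h hκ hn hm, add_comm]
          split_ifs with h1
          · obtain rfl : n = -m := by omega
            push_cast
            ring
          · simp
    · rw [fockVir_one hm.le, map_zero, map_zero, sub_zero]
      rcases le_or_gt 0 n with hn | hn
      · rw [fockVir_one hn, map_zero, map_zero, if_neg (by omega)]
      · exact constantCoeff_fockVir_fockVir_one h hκ hm hn
  have := eq_smul_of_comm_fockOsc h T hcomm p
  rw [hc, hT, sub_sub, sub_eq_iff_eq_add] at this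
  rw [this]
  split_ifs <;> simp [add_comm]

end Fock
-- Vacuum matrix elements as constant terms; contravariance.
section MatrixElement

variable {K : Type*} [Field K] {R : Type*} [CommRing R]

theorem matrixElement_nil (c η : K) : matrixElement c η [] = 1 := by
  rw [matrixElement]

theorem matrixElement_cons (c η : K) (n : ℤ) (w : List ℤ) :
    matrixElement c η (n :: w) =
      if n < 0 then 0
      else if n = 0 then η * matrixElement c η w
      else ∑ i : Fin w.length,
        (((n - w[i] : ℤ) : K) * matrixElement c η (w.set i (n + w[i])) +
          if n + w[i] = 0 then c / 12 * ((n ^ 3 - n : ℤ) : K) * matrixElement c η (w.eraseIdx i)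
          else 0) := by
  rw [matrixElement]

/-- The defining recursion has a unique solution, so any functional on words with the same rules is
the matrix element. It is applied to base change, to words on the Fock space and to adjoint words.
-/
theorem map_matrixElement_eq (f : K →+* R) (c η : K) (T : List ℤ → R) (h0 : T [] = 1)
    (hneg : ∀ n < 0, ∀ w, T (n :: w) = 0) (hzero : ∀ w, T (0 :: w) = f η * T w)
    (hpos : ∀ n > 0, ∀ w : List ℤ, T (n :: w) = ∑ i : Fin w.length,
      (((n - w[i] : ℤ) : R) * T (w.set i (n + w[i])) +
        if n + w[i] = 0 then f (c / 12) * ((n ^ 3 - n : ℤ) : R) * T (w.eraseIdx i) else 0))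
    (w : List ℤ) : f (matrixElement c η w) = T w := by
  induction hl : w.length using Nat.strong_induction_on generalizing w with
  | _ l ih =>
    match w, hl with
    | [], _ => rw [matrixElement_nil, h0, map_one]
    | n :: w, hl =>
      rw [matrixElement_cons]
      rw [List.length_cons] at hl
      rcases lt_trichotomy n 0 with hn | rfl | hn
      · rw [if_pos hn, hneg n hn, map_zero]
      · rw [if_neg (lt_irrefl _), if_pos rfl, map_mul, hzero, ih w.length (by omega) w rfl]
      · rw [if_neg hn.not_gt, if_neg hn.ne', hpos n hn, map_sum]
        refine Finset.sum_congr rfl fun i _ => ?_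
        have hi := i.2
        rw [map_add, map_mul, map_intCast, ih w.length (by omega) _ (List.length_set ..),
          apply_ite f, map_zero, map_mul, map_mul, map_intCast,
          ih (w.length - 1) (by omega) _ (List.length_eraseIdx_of_lt hi)]

theorem map_matrixElement {K' : Type*} [Field K'] (f : K →+* K') (c η : K) (w : List ℤ) :
    f (matrixElement c η w) = matrixElement (f c) (f η) w := by
  refine map_matrixElement_eq f c η _ (matrixElement_nil _ _) (fun n hn w => ?_) (fun w => ?_)
    (fun n hn w => ?_) w
  · rw [matrixElement_cons, if_pos hn]
  · rw [matrixElement_cons, if_neg (lt_irrefl _), if_pos rfl]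
  · rw [matrixElement_cons, if_neg hn.lt.not_gt, if_neg hn.lt.ne', map_div₀, map_ofNat]

open MvPolynomial

/-- The action of a word of Virasoro generators on the Fock space. -/
noncomputable def fockWord (μ ν : R) : List ℤ → Module.End R (MvPolynomial ℕ R)
  | [] => LinearMap.id
  | n :: w => fockVir μ ν n ∘ₗ fockWord μ ν w

/-- The action of the adjoint of a word of Virasoro generators on the Fock space. -/
noncomputable def fockWordAdj (μ ν : R) : List ℤ → Module.End R (MvPolynomial ℕ R)
  | [] => LinearMap.id
  | n :: w => fockWordAdj μ ν w ∘ₗ fockVir μ ν (-n)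

@[simp] theorem fockWord_nil (μ ν : R) (p : MvPolynomial ℕ R) : fockWord μ ν [] p = p := rfl

@[simp] theorem fockWord_cons (μ ν : R) (n : ℤ) (w : List ℤ) (p : MvPolynomial ℕ R) :
    fockWord μ ν (n :: w) p = fockVir μ ν n (fockWord μ ν w p) := rfl

@[simp] theorem fockWordAdj_nil (μ ν : R) (p : MvPolynomial ℕ R) : fockWordAdj μ ν [] p = p := rfl

@[simp] theorem fockWordAdj_cons (μ ν : R) (n : ℤ) (w : List ℤ) (p : MvPolynomial ℕ R) :
    fockWordAdj μ ν (n :: w) p = fockWordAdj μ ν w (fockVir μ ν (-n) p) := rfl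

theorem fockWord_append (μ ν : R) (v w : List ℤ) (p : MvPolynomial ℕ R) :
    fockWord μ ν (v ++ w) p = fockWord μ ν v (fockWord μ ν w p) := by
  induction v with
  | nil => rfl
  | cons n v ih => rw [List.cons_append, fockWord_cons, ih, fockWord_cons]

theorem fockWordAdj_append (μ ν : R) (v w : List ℤ) (p : MvPolynomial ℕ R) :
    fockWordAdj μ ν (v ++ w) p = fockWordAdj μ ν w (fockWordAdj μ ν v p) := by
  induction v generalizing p with
  | nil => rfl
  | cons n v ih => rw [List.cons_append, fockWordAdj_cons, ih, fockWordAdj_cons]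

theorem fockWordAdj_eq (μ ν : R) (w : List ℤ) (p : MvPolynomial ℕ R) :
    fockWordAdj μ ν w p = fockWord μ ν (w.reverse.map fun n => -n) p := by
  induction w generalizing p with
  | nil => rfl
  | cons n w ih =>
    rw [fockWordAdj_cons, ih, List.reverse_cons, List.map_append, fockWord_append]
    rfl

theorem twelve_mul_map_div_twelve [CharZero K] {μ : R} (f : K →+* R) {c : K}
    (hc : f c = 1 - 24 * μ) : 12 * f (c / 12) = 1 - 24 * μ := by
  rw [← hc, ← map_ofNat f 12, ← map_mul]
  congr 1
  field_simp

variable [Algebra ℚ R]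

theorem fockVir_fockWord {μ ν κ : R} (h : 4 * μ * ν = 1) (hκ : 12 * κ = 1 - 24 * μ) (n : ℤ)
    (w : List ℤ) (p : MvPolynomial ℕ R) :
    fockVir μ ν n (fockWord μ ν w p) = fockWord μ ν w (fockVir μ ν n p) +
      ∑ i : Fin w.length, (((n - w[i] : ℤ) : R) • fockWord μ ν (w.set i (n + w[i])) p +
        if n + w[i] = 0 then (κ * ((n ^ 3 - n : ℤ) : R)) • fockWord μ ν (w.eraseIdx i) p
        else 0) := by
  induction w with
  | nil => simp
  | cons a w ih =>
    rw [fockWord_cons, fockVir_commutator h hκ, ih, map_add, fockWord_cons, map_sum]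
    refine Eq.trans ?_ (congrArg _ (Fin.sum_univ_succ _).symm)
    simp only [Fin.getElem_fin, Fin.val_zero, Fin.val_succ, List.getElem_cons_zero,
      List.getElem_cons_succ, List.set_cons_zero, List.set_cons_succ, List.eraseIdx_cons_zero,
      List.eraseIdx_cons_succ, fockWord_cons, map_add, map_smul, apply_ite (fockVir μ ν a),
      map_zero]
    abel

theorem fockWordAdj_fockVir {μ ν κ : R} (h : 4 * μ * ν = 1) (hκ : 12 * κ = 1 - 24 * μ) (n : ℤ)
    (w : List ℤ) (p : MvPolynomial ℕ R) :
    fockWordAdj μ ν w (fockVir μ ν (-n) p) = fockVir μ ν (-n) (fockWordAdj μ ν w p) +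
      ∑ i : Fin w.length, (((n - w[i] : ℤ) : R) • fockWordAdj μ ν (w.set i (n + w[i])) p +
        if n + w[i] = 0 then (κ * ((n ^ 3 - n : ℤ) : R)) • fockWordAdj μ ν (w.eraseIdx i) p
        else 0) := by
  induction w generalizing p with
  | nil => simp
  | cons a w ih =>
    rw [fockWordAdj_cons, fockVir_commutator h hκ, map_add, map_add, ih, fockWordAdj_cons,
      map_smul, apply_ite (fockWordAdj μ ν w), map_smul, map_zero]
    refine Eq.trans ?_ (congrArg _ (Fin.sum_univ_succ _).symm)
    simp only [Fin.getElem_fin, Fin.val_zero, Fin.val_succ, List.getElem_cons_zero,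
      List.getElem_cons_succ, List.set_cons_zero, List.set_cons_succ, List.eraseIdx_cons_zero,
      List.eraseIdx_cons_succ, fockWordAdj_cons]
    have e : -a + -n = 0 ↔ n + a = 0 := by omega
    rw [show -a + -n = -(n + a) by ring] at *
    simp only [e, show -a - -n = n - a by ring]
    by_cases h0 : n + a = 0
    · obtain rfl : a = -n := by omega
      simp only [if_pos h0, show (- -n) ^ 3 - - -n = n ^ 3 - n by ring]
      abel_nf
    · rw [if_neg h0]
      simp only [h0, if_false]
      abel

theorem map_matrixElement_eq_fockWord [CharZero K] {μ ν : R} (h : 4 * μ * ν = 1) (f : K →+* R)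
    {c : K} (hc : f c = 1 - 24 * μ) (w : List ℤ) :
    f (matrixElement c 0 w) = constantCoeff (fockWord μ ν w 1) := by
  have hκ := twelve_mul_map_div_twelve f hc
  refine map_matrixElement_eq f c 0 (fun w => constantCoeff (fockWord μ ν w 1)) (by simp)
    (fun n hn w => ?_) (fun w => ?_) (fun n hn w => ?_) w
  · simp only [fockWord_cons]
    exact constantCoeff_fockVir hn.le _ _ _
  · simp only [fockWord_cons, map_zero, zero_mul]
    exact constantCoeff_fockVir le_rfl _ _ _
  · simp only [fockWord_cons]
    rw [fockVir_fockWord h hκ, fockVir_one hn.le, map_zero, zero_add, map_sum]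
    refine Finset.sum_congr rfl fun i _ => ?_
    simp only [map_add, smul_eq_C_mul, map_mul, constantCoeff_C, apply_ite constantCoeff, map_zero]

/-- Passing to the adjoint exchanges the two vacuum properties, `L_n 1 = 0` for `n ≥ 0` and the
vanishing of the constant term of `L_n p` for `n ≤ 0`, and leaves the recursion unchanged.
Contravariance follows by comparing the two solutions, without constructing a bilinear form. -/
theorem map_matrixElement_eq_fockWordAdj [CharZero K] {μ ν : R} (h : 4 * μ * ν = 1) (f : K →+* R)
    {c : K} (hc : f c = 1 - 24 * μ) (w : List ℤ) :
    f (matrixElement c 0 w) = constantCoeff (fockWordAdj μ ν w 1) := by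
  have hκ := twelve_mul_map_div_twelve f hc
  refine map_matrixElement_eq f c 0 (fun w => constantCoeff (fockWordAdj μ ν w 1)) (by simp)
    (fun n hn w => ?_) (fun w => ?_) (fun n hn w => ?_) w
  · simp only [fockWordAdj_cons]
    rw [fockVir_one (by omega), map_zero, map_zero]
  · simp only [fockWordAdj_cons]
    rw [fockVir_one (by omega), map_zero, map_zero, map_zero, zero_mul]
  · simp only [fockWordAdj_cons]
    rw [fockWordAdj_fockVir h hκ, map_add, constantCoeff_fockVir (by omega), zero_add, map_sum]
    refine Finset.sum_congr rfl fun i _ => ?_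
    simp only [map_add, smul_eq_C_mul, map_mul, constantCoeff_C, apply_ite constantCoeff, map_zero]

/-- The contravariance of the vacuum expectation value. -/
theorem constantCoeff_fockWord [CharZero K] {μ ν : R} (h : 4 * μ * ν = 1) (f : K →+* R)
    {c : K} (hc : f c = 1 - 24 * μ) (w : List ℤ) :
    constantCoeff (fockWord μ ν w 1) = constantCoeff (fockWordAdj μ ν w 1) := by
  rw [← map_matrixElement_eq_fockWord h f hc, map_matrixElement_eq_fockWordAdj h f hc]

end MatrixElement
-- The level grading, and evaluation as the three-point functional.
section Level

open MvPolynomial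

variable {R : Type*} [CommRing R]

/-- The level of a monomial of the Fock space, where `y_n = X (n - 1)` has level `n`. -/
noncomputable def monLevel (m : ℕ →₀ ℕ) : ℕ := m.sum fun i a => a * (i + 1)

/-- The exponent of the monomial `∏ y_k` over the parts `k` of a partition. -/
noncomputable def monOfPartition {n : ℕ} (q : n.Partition) : ℕ →₀ ℕ :=
  Multiset.toFinsupp (q.parts.map Nat.pred)

theorem monOfPartition_injective (n : ℕ) :
    Function.Injective (monOfPartition : n.Partition → ℕ →₀ ℕ) := by
  intro q r h
  have h1 := congrArg (Multiset.map Nat.succ) (Multiset.toFinsupp.injective h)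
  have key : ∀ q : n.Partition, (q.parts.map Nat.pred).map Nat.succ = q.parts := by
    intro q
    rw [Multiset.map_map]
    exact (Multiset.map_congr rfl fun k hk => Nat.succ_pred (q.parts_pos hk).ne').trans
      (Multiset.map_id _)
  rw [key, key] at h1
  exact Nat.Partition.ext h1

theorem exists_monOfPartition (m : ℕ →₀ ℕ) :
    ∃ q : (monLevel m).Partition, monOfPartition q = m := by
  refine ⟨⟨(Finsupp.toMultiset m).map Nat.succ, fun {k} hk => ?_, ?_⟩, ?_⟩
  · obtain ⟨i, _, rfl⟩ := Multiset.mem_map.1 hk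
    exact Nat.succ_pos i
  · rw [Finsupp.toMultiset_apply, Finsupp.sum, ← Multiset.coe_mapAddMonoidHom, map_sum,
      ← Multiset.coe_sumAddMonoidHom, map_sum, monLevel, Finsupp.sum]
    exact Finset.sum_congr rfl fun i _ => by simp [Multiset.sum_nsmul, mul_add]
  · rw [monOfPartition, Multiset.map_map]
    exact (congrArg _ ((Multiset.map_congr rfl fun k _ => rfl).trans
      (Multiset.map_id _))).trans (Finsupp.toMultiset_toFinsupp m)

theorem coeff_fockShift_zero (p : MvPolynomial ℕ R) (m : ℕ →₀ ℕ) :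
    coeff m (fockShift R 0 p) = (monLevel m : R) * coeff m p := by
  have key : ∀ (u : ℕ →₀ ℕ) (a : R),
      fockShift R 0 (monomial u a) = (monLevel u : R) • monomial u a := by
    intro u a
    rw [fockShift, mkDerivation_monomial, monLevel, Finsupp.sum, Finsupp.sum, Nat.cast_sum,
      Finset.sum_smul, Finset.smul_sum]
    refine Finset.sum_congr rfl fun i hi => ?_
    have hu : u - Finsupp.single i 1 + Finsupp.single i 1 = u :=
      tsub_add_cancel_of_le (by
        rw [Finsupp.single_le_iff]; exact Nat.one_le_iff_ne_zero.2 (Finsupp.mem_support_iff.1 hi))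
    rw [sub_zero, fockVar_natCast_add_one, smul_eq_mul, X, mul_smul_comm, monomial_mul, hu,
      smul_monomial, smul_monomial, smul_monomial]
    congr 1
    simp only [smul_eq_mul]
    push_cast
    ring
  induction p using MvPolynomial.induction_on' with
  | monomial u a =>
    rw [key, coeff_smul, smul_eq_mul, coeff_monomial]
    split_ifs with h
    · rw [h]
    · simp
  | add p q hp hq => rw [map_add, coeff_add, coeff_add, hp, hq, mul_add]

/-- An element of the Fock space is homogeneous of level `N`. -/
def IsLevel (N : ℤ) (p : MvPolynomial ℕ R) : Prop := fockShift R 0 p = (N : R) • p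

theorem isLevel_one : IsLevel 0 (1 : MvPolynomial ℕ R) := by simp [IsLevel]

theorem IsLevel.sub {N : ℤ} {p q : MvPolynomial ℕ R} (hp : IsLevel N p) (hq : IsLevel N q) :
    IsLevel N (p - q) := by
  rw [IsLevel, map_sub, hp, hq, smul_sub]

theorem IsLevel.smul {N : ℤ} {p : MvPolynomial ℕ R} (hp : IsLevel N p) (a : R) :
    IsLevel N (a • p) := by
  rw [IsLevel, Derivation.map_smul, hp, smul_comm]

theorem isLevel_sum {ι : Type*} {N : ℤ} (s : Finset ι) (f : ι → MvPolynomial ℕ R)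
    (hf : ∀ i ∈ s, IsLevel N (f i)) : IsLevel N (∑ i ∈ s, f i) := by
  rw [IsLevel, map_sum, Finset.smul_sum]
  exact Finset.sum_congr rfl hf

theorem fockVir_zero (μ ν : R) (p : MvPolynomial ℕ R) : fockVir μ ν 0 p = fockShift R 0 p := by
  simp [fockVir_apply, fockVar_of_nonpos]

/-- The three-point ratios `∏ᵢ ((kᵢ - 1) h + ∑_{j > i} kⱼ)` of the vacuum family. -/
def vacuumVertex (h : R) : List ℕ → R
  | [] => 1
  | k :: w => (((k : R) - 1) * h + (w.sum : R)) * vacuumVertex h w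

theorem vacuumVertex_eq_vertex {K : Type*} [Field K] (h : K) (w : List ℕ) :
    vacuumVertex h w = vertex h 0 w := by
  induction w with
  | nil => rfl
  | cons k w ih => rw [vacuumVertex, vertex, ih, zero_add]

theorem map_vacuumVertex {S : Type*} [CommRing S] (f : R →+* S) (h : R) (w : List ℕ) :
    f (vacuumVertex h w) = vacuumVertex (f h) w := by
  induction w with
  | nil => simp [vacuumVertex]
  | cons k w ih => rw [vacuumVertex, vacuumVertex, map_mul, ih]; simp [-Nat.cast_list_sum]

theorem eval_fockVar (s : R) {k : ℤ} (hk : 0 < k) : eval (fun _ => s) (fockVar R k) = s := by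
  obtain ⟨i, rfl⟩ := exists_natCast_add_one hk
  rw [fockVar_natCast_add_one, eval_X]

theorem eval_fockShift (s : R) {n : ℤ} (hn : n ≤ 0) (p : MvPolynomial ℕ R) :
    eval (fun _ => s) (fockShift R n p) = eval (fun _ => s) (fockShift R 0 p) := by
  induction p using MvPolynomial.induction_on with
  | C a => simp
  | add p q hp hq => rw [map_add, map_add, hp, hq, map_add, map_add]
  | mul_X p i hp =>
    rw [Derivation.leibniz, Derivation.leibniz, ← fockVar_natCast_add_one,
      fockShift_fockVar _ (by positivity), fockShift_fockVar _ (by positivity)]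
    simp [hp, smul_eq_C_mul, eval_fockVar s (show (0 : ℤ) < i + 1 - n by omega),
      eval_fockVar s (show (0 : ℤ) < i + 1 by omega)]

/-- At `y_n = s` the `k - 1` quadratic terms give `s²` each and the linear term gives `2 (k - 1) s`.
The shift `y_i ↦ i y_{i+k}` becomes indistinguishable from the Euler operator and yields the level.
-/
theorem eval_fockVir (μ ν s : R) {k N : ℤ} (hk : 0 < k) {p : MvPolynomial ℕ R}
    (hp : IsLevel N p) :
    eval (fun _ => s) (fockVir μ ν (-k) p) =
      ((k - 1 : R) * (μ * (s ^ 2 + 2 * s)) + N) * eval (fun _ => s) p := by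
  have h1 : eval (fun _ => s) (∑ i ∈ Finset.Ioo 0 k, fockVar R i * fockVar R (k - i) * p) =
      (k - 1) * s ^ 2 * eval (fun _ => s) p := by
    have h2 : ∀ i ∈ Finset.Ioo 0 k, eval (fun _ => s) (fockVar R i * fockVar R (k - i) * p) =
        s ^ 2 * eval (fun _ => s) p := by
      intro i hi
      rw [Finset.mem_Ioo] at hi
      rw [map_mul, map_mul, eval_fockVar s hi.1, eval_fockVar s (by omega), sq]
    rw [map_sum, Finset.sum_congr rfl h2, Finset.sum_const, Int.card_Ioo, nsmul_eq_mul]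
    have : (((k - 0 - 1).toNat : ℕ) : R) = k - 1 := by
      have h3 : (((k - 0 - 1).toNat : ℤ)) = k - 1 := by omega
      have := congrArg (Int.cast (R := R)) h3
      push_cast at this
      exact this
    rw [this, mul_assoc]
  rw [fockVir_apply, fockDeriv_of_nonpos (by omega : -k ≤ 0), neg_neg,
    Finset.Ioo_eq_empty (b := -k) (by omega), map_add, map_add, map_sub, map_add,
    eval_fockShift s (by omega), hp]
  simp only [smul_eq_C_mul, map_mul, h1, eval_C, eval_fockVar s hk, map_zero,
    Finset.sum_empty, Derivation.coe_zero, Pi.zero_apply]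
  push_cast
  ring

variable [Algebra ℚ R]

theorem IsLevel.coeff_eq_zero {N : ℤ} {p : MvPolynomial ℕ R} (hp : IsLevel N p) {m : ℕ →₀ ℕ}
    (hm : (monLevel m : ℤ) ≠ N) : coeff m p = 0 := by
  have h := coeff_fockShift_zero p m
  rw [hp, coeff_smul, smul_eq_mul] at h
  have h2 : (((monLevel m : ℤ) - N : ℤ) : R) * coeff m p = 0 := by
    push_cast
    linear_combination -h
  exact (isUnit_intCast (sub_ne_zero.2 hm)).mul_right_eq_zero.1 h2

theorem IsLevel.eq_zero {N : ℤ} {p : MvPolynomial ℕ R} (hp : IsLevel N p) (hN : N < 0) :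
    p = 0 := by
  ext m
  rw [coeff_zero]
  exact hp.coeff_eq_zero (by omega)

theorem IsLevel.eq_sum {N : ℕ} {p : MvPolynomial ℕ R} (hp : IsLevel (N : ℤ) p) :
    p = ∑ q : N.Partition, coeff (monOfPartition q) p • monomial (monOfPartition q) 1 := by
  ext m
  rw [coeff_sum]
  by_cases hm : monLevel m = N
  · subst hm
    obtain ⟨q, hq⟩ := exists_monOfPartition m
    rw [Finset.sum_eq_single q]
    · rw [coeff_smul, hq, coeff_monomial, if_pos rfl, smul_eq_mul, mul_one]
    · intro r _ hr
      rw [coeff_smul, coeff_monomial, if_neg, smul_zero]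
      exact fun h => hr (monOfPartition_injective _ (h.trans hq.symm))
    · exact fun h => absurd (Finset.mem_univ q) h
  · rw [hp.coeff_eq_zero (by exact_mod_cast hm), Finset.sum_eq_zero]
    intro r _
    rw [coeff_smul, coeff_monomial]
    split_ifs with h
    · rw [h, hp.coeff_eq_zero (by exact_mod_cast hm), zero_smul]
    · rw [smul_zero]

/-- Only the relation with `L_0` is used; its central term vanishes. -/
theorem IsLevel.fockVir {μ ν : R} (h : 4 * μ * ν = 1) {N : ℤ} {p : MvPolynomial ℕ R}
    (hp : IsLevel N p) (n : ℤ) : IsLevel (N - n) (fockVir μ ν n p) := by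
  have hκ : 12 * (algebraMap ℚ R (1 / 12) * (1 - 24 * μ)) = 1 - 24 * μ := by
    rw [← mul_assoc, ← map_ofNat (algebraMap ℚ R) 12, ← map_mul]
    norm_num
  have h1 := fockVir_commutator h hκ 0 n p
  rw [fockVir_zero, fockVir_zero, hp, map_smul, zero_add] at h1
  rw [IsLevel, h1]
  split_ifs with h2
  · subst h2; simp
  · rw [add_zero, ← add_smul]
    push_cast
    ring_nf

theorem isLevel_fockWord {μ ν : R} (h : 4 * μ * ν = 1) (w : List ℤ) :
    IsLevel (-w.sum) (fockWord μ ν w 1) := by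
  induction w with
  | nil => exact isLevel_one
  | cons n w ih =>
    have := ih.fockVir h n
    rwa [List.sum_cons, fockWord_cons, show -(n + w.sum) = -w.sum - n by ring]

/-- The descendant state `L_{-k₁} ⋯ L_{-k_r} |0⟩` in the Fock space. -/
noncomputable def fockDesc (μ ν : R) (w : List ℕ) : MvPolynomial ℕ R :=
  fockWord μ ν (w.map fun k : ℕ => -(k : ℤ)) 1

theorem sum_map_neg_natCast (w : List ℕ) : (w.map fun k : ℕ => -(k : ℤ)).sum = -(w.sum : ℤ) := by
  induction w with
  | nil => rfl
  | cons k w ih => rw [List.map_cons, List.sum_cons, ih, List.sum_cons]; push_cast; ring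

theorem isLevel_fockDesc {μ ν : R} (h : 4 * μ * ν = 1) (w : List ℕ) :
    IsLevel (w.sum : ℤ) (fockDesc μ ν w) := by
  have := isLevel_fockWord h (w.map fun k : ℕ => -(k : ℤ))
  rwa [sum_map_neg_natCast, neg_neg] at this

theorem eval_fockDesc {μ ν : R} (h : 4 * μ * ν = 1) (s : R) (w : List ℕ) (hw : ∀ k ∈ w, 0 < k) :
    eval (fun _ => s) (fockDesc μ ν w) = vacuumVertex (μ * (s ^ 2 + 2 * s)) w := by
  induction w with
  | nil => simp [fockDesc, vacuumVertex]
  | cons k w ih =>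
    have h1 := eval_fockVir μ ν s (k := k) (by exact_mod_cast hw k (by simp))
      (isLevel_fockDesc h w)
    rw [ih fun k hk => hw k (by simp [hk])] at h1
    rw [vacuumVertex]
    simp only [Int.cast_natCast] at h1
    exact h1

end Level
-- Nondegeneracy of the pairing of positive modes with monomials.
section Pairing

open MvPolynomial

variable {R : Type*} [CommRing R] {S : Type*} [CommRing S]

theorem map_fockVar (f : R →+* S) (n : ℤ) : map f (fockVar R n) = fockVar S n := by
  unfold fockVar
  split_ifs <;> simp

theorem map_fockDeriv (f : R →+* S) (n : ℤ) (p : MvPolynomial ℕ R) :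
    map f (fockDeriv R n p) = fockDeriv S n (map f p) := by
  unfold fockDeriv
  split_ifs
  · rw [pderiv_map]
  · simp

theorem map_fockShift (f : R →+* S) (n : ℤ) (p : MvPolynomial ℕ R) :
    map f (fockShift R n p) = fockShift S n (map f p) := by
  induction p using MvPolynomial.induction_on with
  | C a => simp
  | add p q hp hq => rw [map_add, map_add, hp, hq, map_add, map_add]
  | mul_X p i hp =>
    rw [Derivation.leibniz, map_mul, map_X, Derivation.leibniz, map_add, smul_eq_mul, smul_eq_mul,
      smul_eq_mul, smul_eq_mul, map_mul, map_mul, hp, map_X, ← fockVar_natCast_add_one,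
      ← fockVar_natCast_add_one, fockShift_fockVar _ (by positivity),
      fockShift_fockVar _ (by positivity), smul_eq_C_mul, smul_eq_C_mul, map_mul, map_C,
      map_fockVar, map_intCast]

theorem map_fockVir (f : R →+* S) (μ ν : R) (n : ℤ) (p : MvPolynomial ℕ R) :
    map f (fockVir μ ν n p) = fockVir (f μ) (f ν) n (map f p) := by
  simp only [fockVir_apply, smul_eq_C_mul, map_add, map_sub, map_mul, map_sum, map_C,
    map_fockShift, map_fockDeriv, map_fockVar, map_intCast, map_ofNat]

theorem map_fockWord (f : R →+* S) (μ ν : R) (w : List ℤ) (p : MvPolynomial ℕ R) :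
    map f (fockWord μ ν w p) = fockWord (f μ) (f ν) w (map f p) := by
  induction w with
  | nil => rfl
  | cons n w ih => rw [fockWord_cons, map_fockVir, ih, fockWord_cons]

theorem fockVir_congr_of_nonneg (μ μ' ν : R) {n : ℤ} (hn : 0 ≤ n) :
    fockVir μ ν n = fockVir μ' ν n := by
  ext1 i
  ext1
  simp [fockVir_apply, fockVar_of_nonpos (neg_nonpos.2 hn),
    Finset.Ioo_eq_empty (a := 0) (b := -n) (by omega)]

theorem fockWord_congr_of_nonneg (μ μ' ν : R) {w : List ℤ} (hw : ∀ n ∈ w, 0 ≤ n) :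
    fockWord μ ν w = fockWord μ' ν w := by
  induction w with
  | nil => rfl
  | cons n w ih =>
    rw [fockWord, fockWord, ih fun k hk => hw k (by simp [hk]),
      fockVir_congr_of_nonneg μ μ' ν (hw n (by simp))]

/-- The word `L_{k_r} ⋯ L_{k_1}` labelled by a partition with parts `k_1 ≥ ⋯ ≥ k_r`. -/
def raisingWord {n : ℕ} (q : n.Partition) : List ℤ :=
  (descendant q).reverse.map Nat.cast

theorem pos_of_mem_raisingWord {n : ℕ} {q : n.Partition} {k : ℤ} (hk : k ∈ raisingWord q) :
    0 < k := by
  obtain ⟨i, hi, rfl⟩ := List.mem_map.1 hk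
  rw [List.mem_reverse, descendant, Multiset.mem_sort] at hi
  exact_mod_cast q.parts_pos hi

/-- The matrix elements between the words labelled by partitions and the monomials of the Fock
space. -/
noncomputable def fockPairing (μ ν : R) (n : ℕ) : Matrix n.Partition n.Partition R :=
  fun q p => constantCoeff (fockWord μ ν (raisingWord q) (monomial (monOfPartition p) 1))

theorem map_fockPairing (f : R →+* S) (μ ν : R) (n : ℕ) :
    (fockPairing μ ν n).map f = fockPairing (f μ) (f ν) n := by
  ext q p
  rw [Matrix.map_apply, fockPairing, fockPairing, ← constantCoeff_map, map_fockWord, map_monomial,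
    map_one]

theorem fockPairing_congr (μ μ' ν : R) (n : ℕ) : fockPairing μ ν n = fockPairing μ' ν n := by
  ext q p
  rw [fockPairing, fockPairing,
    fockWord_congr_of_nonneg μ μ' ν fun k hk => (pos_of_mem_raisingWord hk).le]

theorem derivation_mem_pow {A : Type*} [CommRing A] [Algebra R A] (d : Derivation R A A)
    (I : Ideal A) (n : ℕ) {x : A} (hx : x ∈ I ^ (n + 1)) : d x ∈ I ^ n := by
  induction n generalizing x with
  | zero => simp
  | succ n ih =>
    rw [pow_succ] at hx
    refine Submodule.mul_induction_on hx (fun a ha b hb => ?_) fun a b ha hb => ?_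
    · rw [Derivation.leibniz, smul_eq_mul, smul_eq_mul]
      refine add_mem (Ideal.mul_mem_right _ _ ha) ?_
      rw [pow_succ']
      exact Ideal.mul_mem_mul hb (ih ha)
    · rw [map_add]
      exact add_mem ha hb

theorem derivation_mem_pow_of_mem {A : Type*} [CommRing A] [Algebra R A] (d : Derivation R A A)
    (I : Ideal A) (hd : ∀ x ∈ I, d x ∈ I) (n : ℕ) {x : A} (hx : x ∈ I ^ n) : d x ∈ I ^ n := by
  induction n generalizing x with
  | zero => simp
  | succ n ih =>
    rw [pow_succ] at hx
    refine Submodule.mul_induction_on hx (fun a ha b hb => ?_) fun a b ha hb => ?_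
    · rw [Derivation.leibniz, smul_eq_mul, smul_eq_mul]
      refine add_mem ?_ ?_
      · rw [pow_succ]
        exact Ideal.mul_mem_mul ha (hd b hb)
      · rw [pow_succ']
        exact Ideal.mul_mem_mul hb (ih ha)
    · rw [map_add]
      exact add_mem ha hb

/-- The ideal of the Fock space generated by the creation variables. -/
noncomputable def fockIdeal (R : Type*) [CommRing R] : Ideal (MvPolynomial ℕ R) :=
  RingHom.ker (constantCoeff : MvPolynomial ℕ R →+* R)

/-- The iterated derivative attached to a word. -/
noncomputable def fockDerivWord (w : List ℤ) (p : MvPolynomial ℕ R) : MvPolynomial ℕ R :=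
  w.foldr (fun n q => fockDeriv R n q) p

theorem fockDerivWord_mem {w : List ℤ} {d e : ℕ} (hd : d = e + w.length) {p : MvPolynomial ℕ R}
    (hp : p ∈ fockIdeal R ^ d) : fockDerivWord w p ∈ fockIdeal R ^ e := by
  induction w generalizing e with
  | nil =>
    obtain rfl : d = e := by simpa using hd
    exact hp
  | cons n w ih =>
    exact derivation_mem_pow _ _ _ (ih (e := e + 1) (by rw [hd, List.length_cons]; ring))

theorem fockVir_add_mem (n : ℤ) {d : ℕ} {p : MvPolynomial ℕ R}
    (hp : p ∈ fockIdeal R ^ d) :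
    fockVir 0 0 n p + ((n * (n + 1) : ℤ) : R) • fockDeriv R n p ∈ fockIdeal R ^ d := by
  have : fockVir 0 0 n p + ((n * (n + 1) : ℤ) : R) • fockDeriv R n p = fockShift R n p := by
    rw [fockVir_apply]
    simp
  rw [this]
  exact derivation_mem_pow_of_mem _ _ (fun x _ => constantCoeff_fockShift n x) _ hp

theorem fockVir_mem (n : ℤ) {d : ℕ} {p : MvPolynomial ℕ R}
    (hp : p ∈ fockIdeal R ^ (d + 1)) : fockVir 0 0 n p ∈ fockIdeal R ^ d := by
  have h1 := fockVir_add_mem n (Ideal.pow_le_pow_right (Nat.le_succ d) hp)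
  have h2 : ((n * (n + 1) : ℤ) : R) • fockDeriv R n p ∈ fockIdeal R ^ d := by
    rw [smul_eq_C_mul]
    exact Ideal.mul_mem_left _ _ (derivation_mem_pow _ _ _ hp)
  exact (add_mem_cancel_right h2).1 h1

/-- At `μ = ν = 0` the shift in `L_n` preserves the powers of the ideal `I` of the variables, while
`-n (n + 1) ∂_n` lowers them by one. To leading order in the `I`-adic filtration a word therefore
acts through its derivatives alone. -/
theorem fockWord_sub_mem {w : List ℤ} {d e : ℕ} (hd : d = e + w.length)
    {p : MvPolynomial ℕ R} (hp : p ∈ fockIdeal R ^ d) :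
    fockWord 0 0 w p - (w.map fun n => -((n * (n + 1) : ℤ) : R)).prod • fockDerivWord w p ∈
      fockIdeal R ^ (e + 1) := by
  induction w generalizing e with
  | nil => simp [fockDerivWord]
  | cons n w ih =>
    have hde : d = (e + 1) + w.length := by rw [hd, List.length_cons]; ring
    have h1 := fockVir_mem n (ih hde)
    have h2 := fockVir_add_mem n (fockDerivWord_mem hde hp)
    have h3 := Ideal.mul_mem_left _ (C (w.map fun n => -((n * (n + 1) : ℤ) : R)).prod) h2
    have h4 := add_mem h1 h3
    rw [map_sub, map_smul] at h4
    convert h4 using 1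
    simp only [fockWord_cons, List.map_cons, List.prod_cons, fockDerivWord,
      List.foldr_cons, smul_eq_C_mul, map_mul, map_neg]
    ring

theorem exists_coeff_fockDerivWord (v : List ℕ) (hv : ∀ k ∈ v, 0 < k) (m : ℕ →₀ ℕ) :
    ∃ a : ℕ, a ≠ 0 ∧ ∀ p : MvPolynomial ℕ R, coeff m (fockDerivWord (v.map Nat.cast) p) =
      a * coeff (m + Multiset.toFinsupp ((v : Multiset ℕ).map Nat.pred)) p := by
  induction v generalizing m with
  | nil => exact ⟨1, one_ne_zero, fun p => by simp [fockDerivWord]⟩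
  | cons k v ih =>
    obtain ⟨i, rfl⟩ : ∃ i, k = i + 1 := Nat.exists_eq_succ_of_ne_zero (hv k (by simp)).ne'
    obtain ⟨a, ha, h⟩ := ih (fun k hk => hv k (by simp [hk])) (m + Finsupp.single i 1)
    refine ⟨a * (m i + 1), by positivity, fun p => ?_⟩
    have h2 : fockDerivWord (((i + 1) :: v).map Nat.cast) p =
        pderiv i (fockDerivWord (v.map Nat.cast) p) := by
      rw [← fockDeriv_natCast_add_one]
      simp [fockDerivWord]
    rw [h2, coeff_pderiv, h p, ← Multiset.cons_coe, Multiset.map_cons, Nat.pred_succ,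
      ← Multiset.singleton_add, map_add, Multiset.toFinsupp_singleton, add_assoc]
    push_cast
    ring

theorem monomial_toFinsupp_mem (s : Multiset ℕ) :
    monomial (Multiset.toFinsupp s) (1 : R) ∈ fockIdeal R ^ s.card := by
  induction s using Multiset.induction_on with
  | empty => simp
  | cons a s ih =>
    rw [← Multiset.singleton_add, map_add, Multiset.toFinsupp_singleton, ← one_mul (1 : R),
      ← monomial_mul, Multiset.card_add, Multiset.card_singleton, pow_add, pow_one]
    refine Ideal.mul_mem_mul ?_ ih
    change constantCoeff (X a : MvPolynomial ℕ R) = 0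
    simp

/-- A word with as many letters as `q` has parts must use every letter as a derivative to reach a
constant from a monomial of at least that degree, so the pairing is triangular in the number of
parts. The diagonal entry is nonzero because `n (n + 1) ≠ 0` for `n > 0`. -/
theorem exists_fockPairing_zero [IsDomain R] [CharZero R] {n : ℕ} (q : n.Partition) :
    ∃ a : R, a ≠ 0 ∧ ∀ p : n.Partition, q.parts.card ≤ p.parts.card →
      fockPairing 0 0 n q p = if p = q then a else 0 := by
  have hv : ∀ k ∈ (descendant q).reverse, 0 < k := fun k hk => by
    rw [List.mem_reverse, descendant, Multiset.mem_sort] at hk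
    exact q.parts_pos hk
  obtain ⟨a, ha, h⟩ := exists_coeff_fockDerivWord (R := R) (descendant q).reverse hv 0
  refine ⟨((raisingWord q).map fun n => -((n * (n + 1) : ℤ) : R)).prod * a,
    mul_ne_zero ?_ (by exact_mod_cast ha), fun p hp => ?_⟩
  · refine List.prod_ne_zero fun h0 => ?_
    obtain ⟨k, hk, h1⟩ := List.mem_map.1 h0
    have hk := pos_of_mem_raisingWord hk
    rw [neg_eq_zero, Int.cast_eq_zero] at h1
    have : 0 < k * (k + 1) := by positivity
    omega
  · have hlen : q.parts.card = 0 + (raisingWord q).length := by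
      simp [raisingWord, descendant]
    have hmem : monomial (monOfPartition p) (1 : R) ∈ fockIdeal R ^ q.parts.card := by
      have := monomial_toFinsupp_mem (R := R) (p.parts.map Nat.pred)
      rw [Multiset.card_map] at this
      exact Ideal.pow_le_pow_right hp this
    have h1 := fockWord_sub_mem hlen hmem
    rw [zero_add, pow_one] at h1
    change constantCoeff _ = 0 at h1
    rw [map_sub, sub_eq_zero] at h1
    rw [fockPairing, h1, smul_eq_C_mul, map_mul, constantCoeff_C, raisingWord, constantCoeff_eq, h]
    have h2 : Multiset.toFinsupp ((((descendant q).reverse : List ℕ) : Multiset ℕ).map Nat.pred) =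
        monOfPartition q := by
      rw [Multiset.coe_reverse, descendant, Multiset.sort_eq, monOfPartition]
    rw [zero_add, h2, coeff_monomial]
    simp only [(monOfPartition_injective n).eq_iff]
    split_ifs <;> simp

theorem det_fockPairing_zero_ne_zero [IsDomain R] [CharZero R] (n : ℕ) :
    (fockPairing (0 : R) 0 n).det ≠ 0 := by
  classical
  intro h
  obtain ⟨v, hv, h0⟩ := Matrix.exists_mulVec_eq_zero_iff.2 h
  -- For a `q` with fewest parts in the support of the kernel vector, row `q` meets the support only
  -- on the diagonal.
  obtain ⟨q, hq, hmin⟩ := (Finset.univ.filter fun q => v q ≠ 0).exists_min_image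
    (fun q => q.parts.card) (by
      obtain ⟨q, hq⟩ := Function.ne_iff.1 hv
      exact ⟨q, by simpa using hq⟩)
  obtain ⟨a, ha, hM⟩ := exists_fockPairing_zero (R := R) q
  have h1 := congrFun h0 q
  rw [Matrix.mulVec, dotProduct, Finset.sum_eq_single q, hM q le_rfl, if_pos rfl] at h1
  · exact mul_ne_zero ha (Finset.mem_filter.1 hq).2 h1
  · intro p _ hpq
    by_cases hp : v p = 0
    · rw [hp, mul_zero]
    · rw [hM p (hmin p (by simpa using hp)), if_neg hpq, zero_mul]
  · exact fun h => absurd (Finset.mem_univ q) h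

/-- Words in positive modes do not involve `μ`, so the determinant lives over the ring `A` of
integral series although `μ` has a pole there. It is nonzero since its reduction, at `ν = 0`, is. -/
theorem det_fockPairing_ne_zero {A F L : Type*} [CommRing A] [CommRing F] [IsDomain F] [CharZero F]
    [CommRing L] (π : A →+* F) (ι : A →+* L) (hι : Function.Injective ι) (μ : L) (ν : A)
    (hν : π ν = 0) (n : ℕ) : (fockPairing μ (ι ν) n).det ≠ 0 := by
  have h1 : π (fockPairing 0 ν n).det ≠ 0 := by
    rw [RingHom.map_det, RingHom.mapMatrix_apply, map_fockPairing, hν, map_zero]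
    exact det_fockPairing_zero_ne_zero n
  have h2 : ι (fockPairing 0 ν n).det ≠ 0 := by
    rw [Ne, map_eq_zero_iff ι hι]
    rintro h
    rw [h, map_zero] at h1
    exact h1 rfl
  rwa [RingHom.map_det, RingHom.mapMatrix_apply, map_fockPairing, fockPairing_congr _ μ] at h2

end Pairing
-- The vectors representing evaluation, and their Ward identities.
section Whittaker

open MvPolynomial

variable {R : Type*} [CommRing R]

theorem lowering_eq {n : ℕ} (q : n.Partition) :
    (raisingWord q).reverse.map (fun k => -k) = (descendant q).map fun k : ℕ => -(k : ℤ) := by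
  simp [raisingWord]

theorem reverse_lowering_eq {n : ℕ} (q : n.Partition) :
    ((descendant q).map fun k : ℕ => -(k : ℤ)).reverse.map (fun k => -k) = raisingWord q := by
  simp [raisingWord, List.map_reverse]

theorem sum_descendant {n : ℕ} (q : n.Partition) : (descendant q).sum = n := by
  rw [descendant, ← Multiset.sum_coe, Multiset.sort_eq, q.parts_sum]

theorem sum_raisingWord {n : ℕ} (q : n.Partition) : (raisingWord q).sum = n := by
  have h := congrArg (Nat.cast (R := ℤ)) (sum_descendant q)
  rw [← h, raisingWord]
  simp

/-- The coefficients of evaluation at `y_n = s` in terms of the words labelled by partitions. -/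
noncomputable def evalVec (μ ν s : R) (N : ℕ) : N.Partition → R :=
  (fockPairing μ ν N).transpose⁻¹.mulVec fun p => eval (fun _ => s) (monomial (monOfPartition p) 1)

/-- The level-`N` component of the Whittaker-type vector of the vacuum block. -/
noncomputable def whittaker (μ ν s : R) (N : ℕ) : MvPolynomial ℕ R :=
  ∑ q : N.Partition, evalVec μ ν s N q • fockDesc μ ν (descendant q)

variable [Algebra ℚ R] {μ ν : R}

theorem eval_eq_sum (hdet : ∀ N, IsUnit (fockPairing μ ν N).det) (s : R) {N : ℕ}
    {p : MvPolynomial ℕ R} (hp : IsLevel (N : ℤ) p) :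
    eval (fun _ => s) p =
      ∑ q : N.Partition, evalVec μ ν s N q * constantCoeff (fockWord μ ν (raisingWord q) p) := by
  have key : ∀ r : N.Partition, eval (fun _ => s) (monomial (monOfPartition r) (1 : R)) =
      ∑ q : N.Partition, evalVec μ ν s N q *
        constantCoeff (fockWord μ ν (raisingWord q) (monomial (monOfPartition r) 1)) := by
    intro r
    have h1 : (fockPairing μ ν N).transpose.mulVec (evalVec μ ν s N) =
        fun p => eval (fun _ => s) (monomial (monOfPartition p) 1) := by
      rw [evalVec, Matrix.mulVec_mulVec, Matrix.mul_nonsing_inv _ (by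
        rw [Matrix.det_transpose]; exact hdet N), Matrix.one_mulVec]
    rw [← congrFun h1 r, Matrix.mulVec, dotProduct]
    exact Finset.sum_congr rfl fun q _ => mul_comm _ _
  rw [hp.eq_sum]
  simp only [map_sum, smul_eq_C_mul, map_mul, eval_C, key, Finset.mul_sum]
  rw [Finset.sum_comm]
  refine Finset.sum_congr rfl fun q _ => Finset.sum_congr rfl fun r _ => ?_
  rw [← smul_eq_C_mul, map_smul, smul_eq_C_mul, map_mul, constantCoeff_C]
  ring

theorem IsLevel.eq_zero_of_pairing (hdet : ∀ N, IsUnit (fockPairing μ ν N).det) {N : ℕ}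
    {p : MvPolynomial ℕ R} (hp : IsLevel (N : ℤ) p)
    (h : ∀ q : N.Partition, constantCoeff (fockWord μ ν (raisingWord q) p) = 0) : p = 0 := by
  have h1 : (fockPairing μ ν N).mulVec (fun q => coeff (monOfPartition q) p) = 0 := by
    ext q
    rw [Pi.zero_apply, ← h q]
    conv_rhs => rw [hp.eq_sum]
    rw [map_sum, map_sum, Matrix.mulVec, dotProduct]
    refine Finset.sum_congr rfl fun r _ => ?_
    rw [map_smul, smul_eq_C_mul, map_mul, constantCoeff_C, fockPairing, mul_comm]
  have h2 := congrArg (fockPairing μ ν N)⁻¹.mulVec h1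
  rw [Matrix.mulVec_mulVec, Matrix.nonsing_inv_mul _ (hdet N), Matrix.one_mulVec,
    Matrix.mulVec_zero] at h2
  rw [hp.eq_sum]
  refine Finset.sum_eq_zero fun q _ => ?_
  rw [congrFun h2 q, Pi.zero_apply, zero_smul]

theorem isLevel_whittaker (h : 4 * μ * ν = 1) (s : R) (N : ℕ) :
    IsLevel (N : ℤ) (whittaker μ ν s N) := by
  refine isLevel_sum _ _ fun q _ => IsLevel.smul ?_ _
  have := isLevel_fockDesc h (descendant q)
  rwa [sum_descendant] at this

theorem isLevel_fockWordAdj (h : 4 * μ * ν = 1) (w : List ℤ) :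
    IsLevel w.sum (fockWordAdj μ ν w 1) := by
  have := isLevel_fockWord h (w.reverse.map fun n => -n)
  rw [fockWordAdj_eq]
  have key : ∀ w : List ℤ, (w.map fun n => -n).sum = -w.sum := fun w => by
    induction w with
    | nil => rfl
    | cons n w ih => rw [List.map_cons, List.sum_cons, List.sum_cons, ih]; ring
  rwa [key, neg_neg, List.sum_reverse] at this

/-- By contravariance the vector built from descendants with weights `evalVec` represents the
evaluation functional against every word of total degree `N`, not only the ordered ones. -/
theorem constantCoeff_fockWord_whittaker (h : 4 * μ * ν = 1)
    (hdet : ∀ N, IsUnit (fockPairing μ ν N).det)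
    (hadj : ∀ w, constantCoeff (fockWord μ ν w 1) = constantCoeff (fockWordAdj μ ν w 1)) (s : R)
    {N : ℕ} {w : List ℤ} (hw : w.sum = N) :
    constantCoeff (fockWord μ ν w (whittaker μ ν s N)) =
      eval (fun _ => s) (fockWordAdj μ ν w 1) := by
  have hl := isLevel_fockWordAdj h w
  rw [hw] at hl
  rw [eval_eq_sum hdet s hl, whittaker, map_sum, map_sum]
  refine Finset.sum_congr rfl fun q _ => ?_
  rw [map_smul, smul_eq_C_mul, map_mul, constantCoeff_C, fockDesc, ← fockWord_append, hadj,
    fockWordAdj_append, fockWordAdj_eq _ _ (List.map _ _), reverse_lowering_eq]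

theorem whittaker_zero (h : 4 * μ * ν = 1) (hdet : ∀ N, IsUnit (fockPairing μ ν N).det)
    (hadj : ∀ w, constantCoeff (fockWord μ ν w 1) = constantCoeff (fockWordAdj μ ν w 1)) (s : R) :
    whittaker μ ν s 0 = 1 := by
  refine sub_eq_zero.1 (((isLevel_whittaker h s 0).sub isLevel_one).eq_zero_of_pairing hdet
    fun q => ?_)
  rw [map_sub, map_sub, constantCoeff_fockWord_whittaker h hdet hadj s (sum_raisingWord q)]
  have : raisingWord q = [] := by
    have : q.parts = 0 := by
      refine Multiset.eq_zero_of_forall_notMem fun k hk => ?_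
      have h1 := Multiset.le_sum_of_mem hk
      rw [q.parts_sum] at h1
      exact (q.parts_pos hk).not_ge h1
    simp [raisingWord, descendant]
  simp [this]

/-- Pairing with a positive word moves `L_k` to the other side as `L_{-k}`, where `eval_fockVir`
applies; the pairing is nondegenerate. -/
theorem fockVir_whittaker (h : 4 * μ * ν = 1) (hdet : ∀ N, IsUnit (fockPairing μ ν N).det)
    (hadj : ∀ w, constantCoeff (fockWord μ ν w 1) = constantCoeff (fockWordAdj μ ν w 1)) (s : R)
    {k N : ℕ} (hk : 0 < k) :
    fockVir μ ν k (whittaker μ ν s (N + k)) =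
      (((k : R) - 1) * (μ * (s ^ 2 + 2 * s)) + N) • whittaker μ ν s N := by
  have hl := (isLevel_whittaker h s (N + k)).fockVir h k
  rw [show ((N + k : ℕ) : ℤ) - k = N by push_cast; ring] at hl
  refine sub_eq_zero.1 ((hl.sub ((isLevel_whittaker h s N).smul _)).eq_zero_of_pairing hdet
    fun q => ?_)
  have h1 := constantCoeff_fockWord_whittaker h hdet hadj s (N := N + k)
    (w := raisingWord q ++ [(k : ℤ)]) (by simp [sum_raisingWord])
  rw [fockWord_append, fockWordAdj_append] at h1
  simp only [fockWord_cons, fockWord_nil, fockWordAdj_cons, fockWordAdj_nil] at h1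
  have hl2 := isLevel_fockWordAdj h (raisingWord q)
  rw [sum_raisingWord] at hl2
  rw [map_sub, map_sub, h1, eval_fockVir μ ν s (by exact_mod_cast hk) hl2, map_smul,
    smul_eq_C_mul, map_mul, constantCoeff_C,
    constantCoeff_fockWord_whittaker h hdet hadj s (sum_raisingWord q)]
  simp

theorem fockVir_whittaker_of_lt (h : 4 * μ * ν = 1) (s : R) {k N : ℕ} (hk : N < k) :
    fockVir μ ν k (whittaker μ ν s N) = 0 :=
  ((isLevel_whittaker h s N).fockVir h k).eq_zero (by omega)

/-- This is the linear system `G v = ρ`. It is solvable although `L_{-1} 1 = 0` makes `G`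
degenerate, because the matrix inverted to define `v` pairs positive modes with all monomials
instead of descendants. -/
theorem sum_fockWord_mul_evalVec (h : 4 * μ * ν = 1) (hdet : ∀ N, IsUnit (fockPairing μ ν N).det)
    (hadj : ∀ w, constantCoeff (fockWord μ ν w 1) = constantCoeff (fockWordAdj μ ν w 1)) (s : R)
    {N : ℕ} (p : N.Partition) :
    ∑ q : N.Partition, constantCoeff (fockWord μ ν
      (raisingWord p ++ (descendant q).map fun k : ℕ => -(k : ℤ)) 1) * evalVec μ ν s N q =
      vacuumVertex (μ * (s ^ 2 + 2 * s)) (descendant p) := by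
  have h1 := constantCoeff_fockWord_whittaker h hdet hadj s (sum_raisingWord p)
  rw [fockWordAdj_eq, lowering_eq] at h1
  have h2 := eval_fockDesc h s (descendant p) fun k hk => by
    rw [descendant, Multiset.mem_sort] at hk
    exact p.parts_pos hk
  rw [← h2, fockDesc, ← h1, whittaker, map_sum, map_sum]
  refine Finset.sum_congr rfl fun q _ => ?_
  rw [map_smul, smul_eq_C_mul, map_mul, constantCoeff_C, fockDesc, fockWord_append, mul_comm]

theorem eval_whittaker (h : 4 * μ * ν = 1) (s : R) (N : ℕ) :
    eval (fun _ => s) (whittaker μ ν s N) = ∑ q : N.Partition,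
      vacuumVertex (μ * (s ^ 2 + 2 * s)) (descendant q) * evalVec μ ν s N q := by
  rw [whittaker, map_sum]
  refine Finset.sum_congr rfl fun q _ => ?_
  rw [smul_eq_C_mul, map_mul, eval_C, eval_fockDesc h s _ fun k hk => by
    rw [descendant, Multiset.mem_sort] at hk
    exact q.parts_pos hk, mul_comm]

end Whittaker
-- Formal logarithms and derivations.
section Log

open PowerSeries

variable {A : Type*} [CommRing A]

theorem hasSubst_sub_one {F : A⟦X⟧} (hF : constantCoeff F = 1) :
    HasSubst (F - 1 : A⟦X⟧) :=
  HasSubst.of_constantCoeff_zero' (by rw [map_sub, hF, map_one, sub_self])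

variable [Algebra ℚ A]

theorem map_logOf {B : Type*} [CommRing B] [Algebra ℚ B] (f : A →+* B) {F : A⟦X⟧}
    (hF : constantCoeff F = 1) : map f (logOf F) = logOf (map f F) := by
  rw [logOf_eq, logOf_eq]
  refine (map_subst (hasSubst_sub_one hF) _).trans ?_
  rw [map_log]
  congr 1
  change map f (F - 1) = _
  rw [map_sub, map_one]

theorem mul_derivative_logOf {F : A⟦X⟧} (hF : constantCoeff F = 1) :
    F * d⁄dX A (logOf F) = d⁄dX A F := by
  have h1 : (1 + X : A⟦X⟧) * d⁄dX A (log A) = 1 := by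
    rw [deriv_log]
    ext n
    rw [add_mul, one_mul, map_add]
    cases n with
    | zero => simp
    | succ n => rw [coeff_succ_X_mul, coeff_mk, coeff_mk, ← map_add, coeff_one]; simp [pow_succ]
  have h2 := congrArg (subst (F - 1)) h1
  rw [subst_mul (hasSubst_sub_one hF), subst_add (hasSubst_sub_one hF),
    subst_X (hasSubst_sub_one hF)] at h2
  have h3 : subst (F - 1) (1 : A⟦X⟧) = (1 : A⟦X⟧) := by
    rw [← coe_substAlgHom (hasSubst_sub_one hF), map_one]
  rw [h3, add_sub_cancel] at h2
  rw [logOf_eq, derivative_subst (hasSubst_sub_one hF), ← mul_assoc, h2, one_mul, map_sub,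
    derivative_one, sub_zero]

theorem eq_zero_of_derivative_eq_mul {G H : A⟦X⟧} (h : d⁄dX A G = H * G)
    (h0 : constantCoeff G = 0) : G = 0 := by
  ext n
  rw [map_zero]
  induction n using Nat.strong_induction_on with
  | _ n ih =>
    cases n with
    | zero => rw [coeff_zero_eq_constantCoeff_apply, h0]
    | succ n =>
      have h1 := congrArg (coeff n) h
      rw [coeff_derivative, coeff_mul, Finset.sum_eq_zero] at h1
      · have h2 : IsUnit (((n + 1 : ℕ) : ℤ) : A) := isUnit_intCast (by positivity)
        push_cast at h2
        exact h2.mul_left_eq_zero.1 h1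
      · intro x hx
        rw [ih x.2 (by
          have := Finset.HasAntidiagonal.mem_antidiagonal.1 hx
          omega), mul_zero]

end Log

section MapDerivation

open PowerSeries

variable {R A : Type*} [CommRing R] [CommRing A] [Algebra R A]

/-- A derivation acting on the coefficients of a power series. -/
noncomputable def mapDer (d : Derivation R A A) (F : A⟦X⟧) : A⟦X⟧ :=
  mk fun n => d (coeff n F)

@[simp] theorem coeff_mapDer (d : Derivation R A A) (F : A⟦X⟧) (n : ℕ) :
    coeff n (mapDer d F) = d (coeff n F) := coeff_mk _ _

theorem mapDer_mul (d : Derivation R A A) (F G : A⟦X⟧) :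
    mapDer d (F * G) = F * mapDer d G + mapDer d F * G := by
  ext n
  simp only [coeff_mapDer, map_add, coeff_mul, map_sum, ← Finset.sum_add_distrib]
  refine Finset.sum_congr rfl fun x _ => ?_
  rw [Derivation.leibniz, smul_eq_mul, smul_eq_mul]
  ring

theorem mapDer_derivative (d : Derivation R A A) (F : A⟦X⟧) :
    mapDer d (d⁄dX A F) = d⁄dX A (mapDer d F) := by
  ext n
  rw [coeff_mapDer, coeff_derivative, coeff_derivative, coeff_mapDer, Derivation.leibniz]
  simp [mul_comm]

/-- The difference `G` of the two sides satisfies `G' = (log F)' G` in `z` and has no constant term,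
hence vanishes. -/
theorem mapDer_eq_mul_mapDer_logOf [Algebra ℚ A] (d : Derivation R A A) {F : A⟦X⟧}
    (hF : constantCoeff F = 1) : mapDer d F = F * mapDer d (logOf F) := by
  rw [← sub_eq_zero]
  refine eq_zero_of_derivative_eq_mul (H := d⁄dX A (logOf F)) ?_ ?_
  · have h1 := mul_derivative_logOf hF
    rw [map_sub, Derivation.leibniz, ← mapDer_derivative, ← mapDer_derivative, ← h1, mapDer_mul]
    simp only [smul_eq_mul]
    ring
  · have h2 := constantCoeff_logOf hF
    rw [← coeff_zero_eq_constantCoeff_apply] at h2 hF ⊢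
    rw [map_sub, coeff_mapDer, hF, Derivation.map_one_eq_zero, coeff_zero_eq_constantCoeff_apply,
      map_mul, ← coeff_zero_eq_constantCoeff_apply, ← coeff_zero_eq_constantCoeff_apply,
      coeff_mapDer, h2, map_zero, mul_zero, sub_zero]

end MapDerivation

/-! ### Hamilton–Jacobi equations for the logarithm of the Whittaker-type vector. -/

section HamiltonJacobi

open MvPolynomial

variable {R : Type*} [CommRing R]

/-- A series of vectors of the Fock space satisfying the conformal Ward identities of the product
of two primaries of weight `η`. -/
structure IsWhittaker (μ ν η : R) (W : (MvPolynomial ℕ R)⟦X⟧) : Prop where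
  constantCoeff_eq : PowerSeries.constantCoeff W = 1
  isLevel : ∀ N : ℕ, IsLevel (N : ℤ) (PowerSeries.coeff N W)
  fockVir_add : ∀ k N : ℕ, 0 < k → fockVir μ ν k (PowerSeries.coeff (N + k) W) =
    (((k : R) - 1) * η + N) • PowerSeries.coeff N W
  fockVir_of_lt : ∀ k N : ℕ, N < k → fockVir μ ν k (PowerSeries.coeff N W) = 0

variable [Algebra ℚ R] {μ ν η : R} {W : (MvPolynomial ℕ R)⟦X⟧}

theorem isWhittaker_whittaker (h : 4 * μ * ν = 1) (hdet : ∀ N, IsUnit (fockPairing μ ν N).det)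
    (hadj : ∀ w, constantCoeff (fockWord μ ν w 1) = constantCoeff (fockWordAdj μ ν w 1)) (s : R) :
    IsWhittaker μ ν (μ * (s ^ 2 + 2 * s)) (PowerSeries.mk (whittaker μ ν s)) where
  constantCoeff_eq := by
    rw [← PowerSeries.coeff_zero_eq_constantCoeff_apply, PowerSeries.coeff_mk,
      whittaker_zero h hdet hadj]
  isLevel N := by
    rw [PowerSeries.coeff_mk]
    exact isLevel_whittaker h s N
  fockVir_add k N hk := by
    rw [PowerSeries.coeff_mk, PowerSeries.coeff_mk, fockVir_whittaker h hdet hadj s hk]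
  fockVir_of_lt k N hk := by
    rw [PowerSeries.coeff_mk, fockVir_whittaker_of_lt h s hk]

/-- Homogeneity of all coefficients says that the level derivation acts as `z d/dz`; equality of two
derivations on `W` passes to `log W` because `W` is a unit. -/
theorem IsWhittaker.isLevel_log (hW : IsWhittaker μ ν η W) (N : ℕ) :
    IsLevel (N : ℤ) (PowerSeries.coeff N (PowerSeries.logOf W)) := by
  have h1 := mapDer_eq_mul_mapDer_logOf (fockShift R 0) hW.constantCoeff_eq
  have h2 : mapDer (fockShift R 0) W = PowerSeries.X * PowerSeries.derivative (MvPolynomial ℕ R) W := by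
    ext1 n
    rw [coeff_mapDer, hW.isLevel n]
    cases n with
    | zero => simp
    | succ n =>
      rw [PowerSeries.coeff_succ_X_mul, PowerSeries.coeff_derivative, smul_eq_C_mul]
      simp [mul_comm]
  have hu : IsUnit W := PowerSeries.isUnit_iff_constantCoeff.2 (by simp [hW.constantCoeff_eq])
  rw [h2, ← mul_derivative_logOf hW.constantCoeff_eq, mul_left_comm] at h1
  have h3 := congrArg (PowerSeries.coeff N) (hu.mul_left_cancel h1)
  rw [coeff_mapDer] at h3
  rw [IsLevel, ← h3]
  cases N with
  | zero => simp
  | succ n =>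
    rw [PowerSeries.coeff_succ_X_mul, PowerSeries.coeff_derivative, smul_eq_C_mul]
    simp [mul_comm]

/-- The Hamilton–Jacobi equations satisfied by the logarithm of a Whittaker-type vector. -/
theorem IsWhittaker.hamiltonJacobi (hW : IsWhittaker μ ν η W) {k : ℕ} (hk : 0 < k) (N : ℕ) :
    fockVir μ ν k (PowerSeries.coeff N (PowerSeries.logOf W)) +
      ν • ∑ i ∈ Finset.Ioo 0 (k : ℤ), ((i * (k - i) : ℤ) : R) •
        ∑ x ∈ Finset.HasAntidiagonal.antidiagonal N, fockDeriv R i (PowerSeries.coeff x.1 (PowerSeries.logOf W)) *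
          fockDeriv R (k - i) (PowerSeries.coeff x.2 (PowerSeries.logOf W)) =
    (if N = k then C (((k : R) - 1) * η) else 0) +
      if k ≤ N then (((N - k : ℕ) : R)) • PowerSeries.coeff (N - k) (PowerSeries.logOf W)
        else 0 := by
  set T := PowerSeries.logOf W with hT
  have hd : ∀ d : Derivation R (MvPolynomial ℕ R) (MvPolynomial ℕ R),
      mapDer d W = W * mapDer d T := fun d => mapDer_eq_mul_mapDer_logOf d hW.constantCoeff_eq
  have hu : IsUnit W := PowerSeries.isUnit_iff_constantCoeff.2 (by simp [hW.constantCoeff_eq])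
  -- `Q` is `W⁻¹ L_k W` for `W = exp T`: a second derivative of `W` gives `∂∂T + ∂T ∂T`.
  let Q : (MvPolynomial ℕ R)⟦X⟧ := mapDer (fockShift R k) T
    + PowerSeries.C (C ν) * ∑ i ∈ Finset.Ioo 0 (k : ℤ), PowerSeries.C (C ((i * (k - i) : ℤ) : R)) *
      (mapDer (fockDeriv R i) (mapDer (fockDeriv R (k - i)) T)
        + mapDer (fockDeriv R i) T * mapDer (fockDeriv R (k - i)) T)
    - PowerSeries.C (C ((k * (k + 1) : ℤ) : R)) * mapDer (fockDeriv R k) T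
  -- The Ward identities in generating form: `L_k W = z ^ k ((k - 1) η + z d/dz) W`, with the
  -- vanishing for `N < k` included.
  have hQ : W * Q = W * (PowerSeries.X ^ k * (PowerSeries.C (C (((k : R) - 1) * η))
      + PowerSeries.X * PowerSeries.derivative (MvPolynomial ℕ R) T)) := by
    have h1 : W * Q = mapDer (fockShift R k) W
        + PowerSeries.C (C ν) * ∑ i ∈ Finset.Ioo 0 (k : ℤ),
          PowerSeries.C (C ((i * (k - i) : ℤ) : R)) *
          mapDer (fockDeriv R i) (mapDer (fockDeriv R (k - i)) W)
        - PowerSeries.C (C ((k * (k + 1) : ℤ) : R)) * mapDer (fockDeriv R k) W := by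
      have h2 : ∑ i ∈ Finset.Ioo 0 (k : ℤ), PowerSeries.C (C ((i * (k - i) : ℤ) : R)) *
          mapDer (fockDeriv R i) (mapDer (fockDeriv R (k - i)) W) =
          W * ∑ i ∈ Finset.Ioo 0 (k : ℤ), PowerSeries.C (C ((i * (k - i) : ℤ) : R)) *
            (mapDer (fockDeriv R i) (mapDer (fockDeriv R (k - i)) T)
              + mapDer (fockDeriv R i) T * mapDer (fockDeriv R (k - i)) T) := by
        rw [Finset.mul_sum]
        refine Finset.sum_congr rfl fun i _ => ?_
        rw [hd (fockDeriv R (k - i)), mapDer_mul, hd (fockDeriv R i)]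
        ring
      rw [h2, hd (fockShift R k), hd (fockDeriv R k)]
      ring
    have h2 : W * (PowerSeries.X ^ k * (PowerSeries.C (C (((k : R) - 1) * η))
        + PowerSeries.X * PowerSeries.derivative (MvPolynomial ℕ R) T)) =
        PowerSeries.X ^ k * (PowerSeries.C (C (((k : R) - 1) * η)) * W
          + PowerSeries.X * PowerSeries.derivative (MvPolynomial ℕ R) W) := by
      rw [← mul_derivative_logOf hW.constantCoeff_eq]
      ring
    rw [h1, h2]
    ext1 n
    have h3 : PowerSeries.coeff n (mapDer (fockShift R k) W
        + PowerSeries.C (C ν) * ∑ i ∈ Finset.Ioo 0 (k : ℤ),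
          PowerSeries.C (C ((i * (k - i) : ℤ) : R)) *
          mapDer (fockDeriv R i) (mapDer (fockDeriv R (k - i)) W)
        - PowerSeries.C (C ((k * (k + 1) : ℤ) : R)) * mapDer (fockDeriv R k) W) =
        fockVir μ ν k (PowerSeries.coeff n W) := by
      rw [fockVir_apply, fockVar_of_nonpos (by omega : -(k : ℤ) ≤ 0),
        Finset.Ioo_eq_empty (b := -(k : ℤ)) (by omega)]
      simp only [map_add, map_sub, PowerSeries.coeff_C_mul, coeff_mapDer, map_sum, smul_eq_C_mul]
      simp
    rw [h3, PowerSeries.coeff_X_pow_mul']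
    split_ifs with hn
    · obtain ⟨m, rfl⟩ := Nat.exists_eq_add_of_le' hn
      rw [hW.fockVir_add k m hk, Nat.add_sub_cancel, map_add, PowerSeries.coeff_C_mul, add_smul,
        smul_eq_C_mul, smul_eq_C_mul]
      congr 1
      cases m with
      | zero => simp
      | succ m =>
        rw [PowerSeries.coeff_succ_X_mul, PowerSeries.coeff_derivative]
        simp [mul_comm]
    · exact hW.fockVir_of_lt k n (not_le.1 hn)
  have hQ' := congrArg (PowerSeries.coeff N) (hu.mul_left_cancel hQ)
  have h4 : PowerSeries.coeff N Q = fockVir μ ν k (PowerSeries.coeff N T) +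
      ν • ∑ i ∈ Finset.Ioo 0 (k : ℤ), ((i * (k - i) : ℤ) : R) •
        ∑ x ∈ Finset.HasAntidiagonal.antidiagonal N, fockDeriv R i (PowerSeries.coeff x.1 T) *
          fockDeriv R (k - i) (PowerSeries.coeff x.2 T) := by
    rw [fockVir_apply, fockVar_of_nonpos (by omega : -(k : ℤ) ≤ 0),
      Finset.Ioo_eq_empty (b := -(k : ℤ)) (by omega)]
    simp only [Q, map_add, map_sub, PowerSeries.coeff_C_mul, coeff_mapDer, map_sum, smul_eq_C_mul,
      mul_add, Finset.sum_add_distrib]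
    simp only [PowerSeries.coeff_mul, coeff_mapDer, Finset.sum_empty, zero_mul, mul_zero, add_zero]
    ring
  rw [← h4, hQ', PowerSeries.coeff_X_pow_mul']
  by_cases hn : k ≤ N
  · rw [if_pos hn, if_pos hn, map_add, PowerSeries.coeff_C]
    congr 1
    · have e : N - k = 0 ↔ N = k := by omega
      simp only [e]
    · generalize N - k = m
      cases m with
      | zero => simp
      | succ m =>
        rw [PowerSeries.coeff_succ_X_mul, PowerSeries.coeff_derivative, smul_eq_C_mul]
        simp [mul_comm]
  · rw [if_neg hn, if_neg hn, if_neg (by omega), add_zero]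

end HamiltonJacobi
-- Integrality of the solution of the Hamilton–Jacobi equations.
section Integrality

open MvPolynomial

variable {R : Type*} [CommRing R]

theorem derivation_sum_apply {ι A : Type*} [CommRing A] [Algebra R A] (t : Finset ι)
    (d : ι → Derivation R A A) (x : A) : (∑ i ∈ t, d i) x = ∑ i ∈ t, d i x := by
  classical
  induction t using Finset.induction_on with
  | empty => simp
  | insert a t ha ih => rw [Finset.sum_insert ha, Finset.sum_insert ha, Derivation.add_apply, ih]

theorem fockShift_eq_sum (n : ℤ) {p : MvPolynomial ℕ R} {b : ℕ} (hb : ∀ i ∈ p.vars, i < b) :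
    fockShift R n p =
      ∑ i ∈ Finset.range b, ((i : R) + 1) • fockVar R (i + 1 - n) * pderiv i p := by
  have h1 : fockShift R n p = (∑ i ∈ Finset.range b,
      (((i : R) + 1) • fockVar R (i + 1 - n)) • pderiv (R := R) i) p := by
    refine derivation_eq_of_forall_mem_vars fun j hj => ?_
    rw [derivation_sum_apply, Finset.sum_eq_single j]
    · rw [Derivation.smul_apply, pderiv_X_self, smul_eq_mul, mul_one, fockShift, mkDerivation_X]
    · intro i _ hij
      rw [Derivation.smul_apply, pderiv_X_of_ne hij.symm, smul_zero]
    · exact fun h => absurd (Finset.mem_range.2 (hb j hj)) h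
  rw [h1, derivation_sum_apply]
  rfl

variable [Algebra ℚ R]

/-- The polynomials all of whose coefficients lie in a given subalgebra. -/
noncomputable def polySubalgebra (B : Subalgebra ℚ R) : Subalgebra ℚ (MvPolynomial ℕ R) where
  carrier := {p | ∀ m, coeff m p ∈ B}
  mul_mem' {p q} hp hq m := by
    rw [coeff_mul]
    exact sum_mem fun x _ => mul_mem (hp _) (hq _)
  add_mem' {p q} hp hq m := by
    rw [coeff_add]
    exact add_mem (hp _) (hq _)
  algebraMap_mem' r m := by
    rw [IsScalarTower.algebraMap_apply ℚ R (MvPolynomial ℕ R), algebraMap_eq, coeff_C]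
    split_ifs
    · exact B.algebraMap_mem r
    · exact zero_mem B

variable {B : Subalgebra ℚ R}

theorem smul_mem_polySubalgebra {a : R} (ha : a ∈ B) {p : MvPolynomial ℕ R}
    (hp : p ∈ polySubalgebra B) : a • p ∈ polySubalgebra B := fun m => by
  rw [coeff_smul]
  exact mul_mem ha (hp m)

theorem C_mem_polySubalgebra {a : R} (ha : a ∈ B) : C a ∈ polySubalgebra B := fun m => by
  rw [coeff_C]
  split_ifs
  exacts [ha, zero_mem B]

theorem fockVar_mem_polySubalgebra (n : ℤ) : fockVar R n ∈ polySubalgebra B := fun m => by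
  unfold fockVar
  split_ifs
  · rw [coeff_X]
    split_ifs
    exacts [one_mem B, zero_mem B]
  · exact zero_mem B

theorem pderiv_mem_polySubalgebra (i : ℕ) {p : MvPolynomial ℕ R} (hp : p ∈ polySubalgebra B) :
    pderiv i p ∈ polySubalgebra B := fun m => by
  rw [coeff_pderiv]
  exact mul_mem (hp _) (add_mem (natCast_mem B _) (one_mem B))

theorem fockDeriv_mem_polySubalgebra (n : ℤ) {p : MvPolynomial ℕ R} (hp : p ∈ polySubalgebra B) :
    fockDeriv R n p ∈ polySubalgebra B := by
  unfold fockDeriv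
  split_ifs
  · exact pderiv_mem_polySubalgebra _ hp
  · exact zero_mem _

theorem smul_mem_polySubalgebra_iff {k : ℤ} (hk : k ≠ 0) {p : MvPolynomial ℕ R} :
    (k : R) • p ∈ polySubalgebra B ↔ p ∈ polySubalgebra B := by
  refine ⟨fun h => ?_, fun h => smul_mem_polySubalgebra (intCast_mem B k) h⟩
  have h1 := smul_mem_polySubalgebra (B.algebraMap_mem (1 / k : ℚ)) h
  rwa [smul_smul, ← map_intCast (algebraMap ℚ R), ← map_mul,
    one_div_mul_cancel (by exact_mod_cast hk), map_one, one_smul] at h1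

/-- The first-order part of `L_{i+1}` expresses `∂_i p` through `∂_j p` with `j > i`, since the
shift only produces `y_{j-i}`. Downward induction from a bound on the variables makes all
derivatives integral, and the Euler identity at the nonzero level `N` then recovers `p`. -/
theorem mem_polySubalgebra_of_level {N : ℤ} (hN : N ≠ 0) {p : MvPolynomial ℕ R}
    (hp : IsLevel N p) (h : ∀ k : ℕ, 0 < k → fockShift R k p -
      ((k * (k + 1) : ℤ) : R) • fockDeriv R k p ∈ polySubalgebra B) : p ∈ polySubalgebra B := by
  obtain ⟨b, hb⟩ : ∃ b, ∀ i ∈ p.vars, i < b := by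
    obtain ⟨b, hb⟩ := p.vars.exists_nat_subset_range
    exact ⟨b, fun i hi => Finset.mem_range.1 (hb hi)⟩
  have key : ∀ d i : ℕ, b ≤ i + d → pderiv i p ∈ polySubalgebra B := by
    intro d
    induction d with
    | zero =>
      intro i hi
      rw [pderiv_eq_zero_of_notMem_vars fun h => by have := hb i h; omega]
      exact zero_mem _
    | succ d ih =>
      intro i hi
      have h1 := h (i + 1) (Nat.succ_pos i)
      have h2 : fockShift R ((i + 1 : ℕ) : ℤ) p ∈ polySubalgebra B := by
        rw [fockShift_eq_sum _ hb]
        refine sum_mem fun j _ => ?_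
        rcases le_or_gt j i with hj | hj
        · rw [fockVar_of_nonpos (by push_cast; omega), smul_zero, zero_mul]
          exact zero_mem _
        · exact mul_mem (smul_mem_polySubalgebra (add_mem (natCast_mem B _) (one_mem B))
            (fockVar_mem_polySubalgebra _)) (ih j (by omega))
      have h3 := sub_mem h2 h1
      rw [sub_sub_cancel, smul_mem_polySubalgebra_iff (by positivity), Nat.cast_succ,
        fockDeriv_natCast_add_one] at h3
      exact h3
  rw [← smul_mem_polySubalgebra_iff hN, ← hp, fockShift_eq_sum _ hb]
  exact sum_mem fun j _ => mul_mem (smul_mem_polySubalgebra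
    (add_mem (natCast_mem B _) (one_mem B)) (fockVar_mem_polySubalgebra _)) (key b j (by omega))

theorem exists_pow_smul_mem_polySubalgebra {ν : R} (hν : ν ∈ B)
    (hden : ∀ r : R, ∃ n : ℕ, ν ^ n * r ∈ B) (p : MvPolynomial ℕ R) :
    ∃ n : ℕ, ν ^ n • p ∈ polySubalgebra B := by
  induction p using MvPolynomial.induction_on' with
  | monomial u a =>
    obtain ⟨n, hn⟩ := hden a
    refine ⟨n, fun m => ?_⟩
    rw [coeff_smul, coeff_monomial]
    split_ifs
    · exact hn
    · rw [smul_zero]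
      exact zero_mem B
  | add p q hp hq =>
    obtain ⟨m, hm⟩ := hp
    obtain ⟨n, hn⟩ := hq
    refine ⟨m + n, ?_⟩
    rw [smul_add]
    refine add_mem ?_ ?_
    · rw [pow_add, mul_comm, mul_smul]
      exact smul_mem_polySubalgebra (pow_mem hν n) hm
    · rw [pow_add, mul_smul]
      exact smul_mem_polySubalgebra (pow_mem hν m) hn

/-- If `ν ^ (n + 1) p` is integral, so is the second-order part of `L_k (ν ^ n p)`, which carries an
extra `ν`. The first-order criterion then applies to `ν ^ n p`, and a denominator is removed one
power of `ν` at a time. -/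
theorem mem_polySubalgebra_of_fockVir {μ ν : R} (hν : ν ∈ B)
    (hden : ∀ r : R, ∃ n : ℕ, ν ^ n * r ∈ B) {N : ℤ} (hN : N ≠ 0) {p : MvPolynomial ℕ R}
    (hp : IsLevel N p) (h : ∀ k : ℕ, 0 < k → fockVir μ ν k p ∈ polySubalgebra B) :
    p ∈ polySubalgebra B := by
  have key : ∀ n : ℕ, ν ^ n • p ∈ polySubalgebra B → p ∈ polySubalgebra B := by
    intro n
    induction n with
    | zero => rw [pow_zero, one_smul]; exact id
    | succ n ih =>
      intro hn
      refine ih (mem_polySubalgebra_of_level hN (hp.smul _) fun k hk => ?_)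
      have h1 := smul_mem_polySubalgebra (pow_mem hν n) (h k hk)
      rw [← map_smul, fockVir_apply, fockVar_of_nonpos (by omega : -(k : ℤ) ≤ 0),
        Finset.Ioo_eq_empty (b := -(k : ℤ)) (by omega), Finset.sum_empty, zero_mul, smul_zero,
        smul_zero, add_zero, add_zero] at h1
      have h2 : ν • ∑ i ∈ Finset.Ioo 0 (k : ℤ), ((i * (k - i) : ℤ) : R) •
          fockDeriv R i (fockDeriv R (k - i) (ν ^ n • p)) ∈ polySubalgebra B := by
        rw [Finset.smul_sum]
        refine sum_mem fun i _ => ?_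
        rw [smul_comm ν, ← Derivation.map_smul (fockDeriv R i) ν, ← Derivation.map_smul _ ν,
          smul_smul, ← pow_succ']
        exact smul_mem_polySubalgebra (intCast_mem B _)
          (fockDeriv_mem_polySubalgebra _ (fockDeriv_mem_polySubalgebra _ hn))
      have h3 := sub_mem h1 h2
      convert h3 using 1
      abel
  obtain ⟨n, hn⟩ := exists_pow_smul_mem_polySubalgebra hν hden p
  exact key n hn

/-- The logarithm of a Whittaker-type vector with weight `μ ε` is `μ` times an integral element. -/
theorem IsWhittaker.smul_log_mem {μ ν ε : R} {W : (MvPolynomial ℕ R)⟦X⟧} (h : 4 * μ * ν = 1)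
    (hW : IsWhittaker μ ν (μ * ε) W) (hν : ν ∈ B) (hε : ε ∈ B)
    (hden : ∀ r : R, ∃ n : ℕ, ν ^ n * r ∈ B) (N : ℕ) :
    (4 * ν) • PowerSeries.coeff N (PowerSeries.logOf W) ∈ polySubalgebra B := by
  induction N using Nat.strong_induction_on with
  | _ N ih =>
    have h0 : PowerSeries.coeff 0 (PowerSeries.logOf W) = 0 := by
      rw [PowerSeries.coeff_zero_eq_constantCoeff_apply,
        PowerSeries.constantCoeff_logOf hW.constantCoeff_eq]
    rcases Nat.eq_zero_or_pos N with rfl | hN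
    · rw [h0, smul_zero]
      exact zero_mem _
    refine mem_polySubalgebra_of_fockVir (μ := μ) hν hden (N := N) (by exact_mod_cast hN.ne')
      ((hW.isLevel_log N).smul _) fun k hk => ?_
    have h1 := hW.hamiltonJacobi hk N
    rw [← eq_sub_iff_add_eq] at h1
    rw [map_smul, h1, smul_sub, smul_add]
    refine sub_mem (add_mem ?_ ?_) ?_
    · split_ifs
      · rw [smul_eq_C_mul, ← map_mul,
          show 4 * ν * (((k : R) - 1) * (μ * ε)) = ((k : R) - 1) * ε by
            linear_combination ((k : R) - 1) * ε * h]
        exact C_mem_polySubalgebra (mul_mem (sub_mem (natCast_mem B _) (one_mem B)) hε)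
      · rw [smul_zero]
        exact zero_mem _
    · split_ifs
      · rw [smul_comm]
        exact smul_mem_polySubalgebra (natCast_mem B _) (ih _ (by omega))
      · rw [smul_zero]
        exact zero_mem _
    · simp only [Finset.smul_sum]
      refine sum_mem fun i _ => sum_mem fun x hx => ?_
      have hx := Finset.HasAntidiagonal.mem_antidiagonal.1 hx
      have hmem : ∀ j < N, ∀ l : ℤ,
          fockDeriv R l ((4 * ν) • PowerSeries.coeff j (PowerSeries.logOf W)) ∈ polySubalgebra B :=
        fun j hj l => fockDeriv_mem_polySubalgebra _ (ih j hj)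
      rw [smul_comm (4 * ν) ν, smul_comm (4 * ν) ((i * (k - i) : ℤ) : R), smul_comm ν]
      refine smul_mem_polySubalgebra (intCast_mem B _) ?_
      -- As `log W` has no constant term in `z`, the end terms of the convolution vanish and only
      -- levels below `N` remain.
      rcases Nat.eq_zero_or_pos x.1 with hx1 | hx1
      · rw [hx1, h0, map_zero, zero_mul, smul_zero, smul_zero]
        exact zero_mem _
      rcases Nat.eq_zero_or_pos x.2 with hx2 | hx2
      · rw [hx2, h0, map_zero, mul_zero, smul_zero, smul_zero]
        exact zero_mem _
      -- Since `4 (4 ν) ν = (4 ν)²`, each factor of the quadratic term receives its own `4 ν`.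
      rw [← smul_mem_polySubalgebra_iff (k := 4) (by norm_num)]
      convert mul_mem (hmem x.1 (by omega) i) (hmem x.2 (by omega) (k - i)) using 1
      rw [Derivation.map_smul, Derivation.map_smul, smul_mul_smul_comm, smul_smul, smul_smul]
      congr 1
      push_cast
      ring

theorem eval_mem_of_mem_polySubalgebra {s : R} (hs : s ∈ B) {p : MvPolynomial ℕ R}
    (hp : p ∈ polySubalgebra B) : eval (fun _ => s) p ∈ B := by
  rw [eval_eq]
  exact sum_mem fun m _ => mul_mem (hp m) (prod_mem fun i _ => pow_mem hs _)

end Integrality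
-- Gram matrix and independence of the chosen solution.
section Gram

open MvPolynomial

variable {K : Type*} [Field K] {R : Type*} [CommRing R]

theorem gram_apply (c η : K) (n : ℕ) (p q : n.Partition) : gram c η n p q = matrixElement c η
    (raisingWord p ++ (descendant q).map fun k : ℕ => -(k : ℤ)) := by
  have h : ∀ l : List ℕ, (do let a ← l; pure (a : ℤ)) = l.map (Nat.cast : ℕ → ℤ) := fun l => by
    simp [← List.map_eq_flatMap]
  rw [gram, raisingWord]
  simp only [h, List.map_map]
  simp [Function.comp_def]

/-- If `G u = G v = ρ` with `G` symmetric, then `ρ · u = v · G u = ρ · v`. Exhibiting `v` also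
excludes the default value `0`. -/
theorem blockCoeff_eq_dotProduct {h η c : K} {n : ℕ} (hG : (gram c η n).IsSymm)
    (v : n.Partition → K) (hv : (gram c η n).mulVec v = fun p => vertex h η (descendant p)) :
    blockCoeff h η c n = (fun p => vertex h η (descendant p)) ⬝ᵥ v := by
  have H : ∃ v : n.Partition → K,
      (gram c η n).mulVec v = fun p => vertex h η (descendant p) := ⟨v, hv⟩
  unfold blockCoeff
  simp only [dif_pos H]
  have h1 := H.choose_spec
  generalize H.choose = u at h1
  rw [← hv, dotProduct_comm, Matrix.dotProduct_mulVec, ← Matrix.mulVec_transpose, hG.eq, h1, hv]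

theorem isSymm_gram_zero [CharZero K] [Algebra ℚ R] [Nontrivial R] {μ ν : R}
    (h : 4 * μ * ν = 1) (f : K →+* R) {c : K} (hc : f c = 1 - 24 * μ) (n : ℕ) :
    (gram c 0 n).IsSymm := by
  ext p q
  apply f.injective
  rw [Matrix.transpose_apply, gram_apply, gram_apply, map_matrixElement_eq_fockWord h f hc,
    map_matrixElement_eq_fockWordAdj h f hc, fockWordAdj_append, fockWordAdj_eq _ _ (List.map _ _),
    reverse_lowering_eq, fockWordAdj_eq, lowering_eq, fockWord_append]

end Gram

/-! ### The block as a polynomial in `ε = h / μ`. -/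

section Universal

open Polynomial

variable {L : Type*} [Field L]

/-- The extension of the polynomials in `ε = h / μ` by a root `s` of `s² + 2 s = ε`. -/
abbrev WeightExt (L : Type*) [Field L] : Type _ := QuadraticAlgebra L[X] X (-2)

/-- The inclusion of the polynomials in `ε`. -/
noncomputable def weightHom (L : Type*) [Field L] : L[X] →+* WeightExt L :=
  algebraMap L[X] (QuadraticAlgebra L[X] X (-2))

/-- The inclusion of the scalars. -/
noncomputable def scalarHom (L : Type*) [Field L] : L →+* WeightExt L :=
  (weightHom L).comp C

/-- The root `s` of `s² + 2 s = ε`. -/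
noncomputable def weightRoot (L : Type*) [Field L] : WeightExt L := ⟨0, 1⟩

theorem weightHom_injective : Function.Injective (weightHom L) :=
  QuadraticAlgebra.algebraMap_injective

@[simp] theorem re_weightHom (p : L[X]) : (weightHom L p).re = p := rfl

@[simp] theorem im_weightHom (p : L[X]) : (weightHom L p).im = 0 := rfl

theorem weightRoot_eq : weightRoot L ^ 2 + 2 * weightRoot L = weightHom L X := by
  rw [sq, two_mul]
  ext1
  · simp [weightRoot]
  · simp [weightRoot]
    ring

theorem mul_weightRoot (μ : L) : scalarHom L μ * (weightRoot L ^ 2 + 2 * weightRoot L) =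
    weightHom L (C μ * X) := by
  rw [weightRoot_eq, map_mul]
  rfl

variable {c μ ν : L}

theorem four_mul_scalarHom (h : 4 * μ * ν = 1) : 4 * scalarHom L μ * scalarHom L ν = 1 := by
  rw [← map_ofNat (scalarHom L) 4, ← map_mul, ← map_mul, h, map_one]

theorem scalarHom_charge (hc : c = 1 - 24 * μ) : scalarHom L c = 1 - 24 * scalarHom L μ := by
  rw [hc, map_sub, map_mul, map_one, map_ofNat]

theorem isUnit_det_fockPairing (hdet : ∀ N, (fockPairing μ ν N).det ≠ 0) (N : ℕ) :
    IsUnit (fockPairing (scalarHom L μ) (scalarHom L ν) N).det := by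
  rw [← map_fockPairing, ← RingHom.mapMatrix_apply, ← RingHom.map_det]
  exact IsUnit.map _ (isUnit_iff_ne_zero.2 (hdet N))

/-- The universal solution of the linear system defining the vacuum block. -/
noncomputable def universalVec (μ ν : L) (N : ℕ) (q : N.Partition) : L[X] :=
  (evalVec (scalarHom L μ) (scalarHom L ν) (weightRoot L) N q).re

/-- The coefficients of the vacuum block as polynomials in `ε = h / μ`. -/
noncomputable def universalCoeff (μ ν : L) (N : ℕ) : L[X] :=
  ∑ q : N.Partition, vacuumVertex (C μ * X) (descendant q) * universalVec μ ν N q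

variable [CharZero L]

theorem scalarHom_contravariant (hc : c = 1 - 24 * μ) (h : 4 * μ * ν = 1) (w : List ℤ) :
    MvPolynomial.constantCoeff (fockWord (scalarHom L μ) (scalarHom L ν) w 1) =
      MvPolynomial.constantCoeff (fockWordAdj (scalarHom L μ) (scalarHom L ν) w 1) :=
  constantCoeff_fockWord (four_mul_scalarHom h) (scalarHom L) (scalarHom_charge hc) w

theorem sum_gram_mul_evalVec (hc : c = 1 - 24 * μ) (h : 4 * μ * ν = 1)
    (hdet : ∀ N, (fockPairing μ ν N).det ≠ 0) (N : ℕ) (p : N.Partition) :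
    ∑ q : N.Partition, weightHom L (C (gram c 0 N p q)) *
      evalVec (scalarHom L μ) (scalarHom L ν) (weightRoot L) N q =
      weightHom L (vacuumVertex (C μ * X) (descendant p)) := by
  have h1 := sum_fockWord_mul_evalVec (four_mul_scalarHom h) (isUnit_det_fockPairing hdet)
    (scalarHom_contravariant hc h) (weightRoot L) p
  rw [mul_weightRoot, ← map_vacuumVertex] at h1
  rw [← h1]
  refine Finset.sum_congr rfl fun q _ => ?_
  rw [gram_apply, ← map_matrixElement_eq_fockWord (four_mul_scalarHom h) (scalarHom L)
    (scalarHom_charge hc)]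
  rfl

/-- The Gram matrix and `ρ` do not involve `s`, so the `s`-free component of a solution is again a
solution. This removes the square root of the weight from the linear system. -/
theorem sum_gram_mul_universalVec (hc : c = 1 - 24 * μ) (h : 4 * μ * ν = 1)
    (hdet : ∀ N, (fockPairing μ ν N).det ≠ 0) (N : ℕ) (p : N.Partition) :
    ∑ q : N.Partition, C (gram c 0 N p q) * universalVec μ ν N q =
      vacuumVertex (C μ * X) (descendant p) := by
  have h1 := congrArg (QuadraticAlgebra.reₗ (R := L[X]) X (-2))
    (sum_gram_mul_evalVec hc h hdet N p)
  rw [map_sum] at h1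
  refine Eq.trans (Finset.sum_congr rfl fun q _ => ?_) h1
  simp [universalVec, QuadraticAlgebra.reₗ]

theorem isSymm_gram (hc : c = 1 - 24 * μ) (h : 4 * μ * ν = 1) (N : ℕ) : (gram c 0 N).IsSymm :=
  isSymm_gram_zero (four_mul_scalarHom h) (scalarHom L) (scalarHom_charge hc) N

/-- The solution with `s` and its `s`-free component give the same value, again by symmetry of the
Gram matrix. -/
theorem weightHom_universalCoeff (hc : c = 1 - 24 * μ) (h : 4 * μ * ν = 1)
    (hdet : ∀ N, (fockPairing μ ν N).det ≠ 0) (N : ℕ) :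
    weightHom L (universalCoeff μ ν N) = MvPolynomial.eval (fun _ => weightRoot L)
        (whittaker (scalarHom L μ) (scalarHom L ν) (weightRoot L) N) := by
  rw [eval_whittaker (four_mul_scalarHom h), mul_weightRoot, universalCoeff, map_sum]
  have h0 : ∀ q, weightHom L (vacuumVertex (C μ * X) (descendant q) * universalVec μ ν N q) =
      ∑ r : N.Partition, weightHom L (C (gram c 0 N q r)) *
        evalVec (scalarHom L μ) (scalarHom L ν) (weightRoot L) N r *
        weightHom L (universalVec μ ν N q) := fun q => by
    rw [map_mul, ← sum_gram_mul_evalVec hc h hdet, Finset.sum_mul]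
  rw [Finset.sum_congr rfl fun q _ => h0 q, Finset.sum_comm]
  refine Finset.sum_congr rfl fun q _ => ?_
  have h1 : ∑ p, weightHom L (C (gram c 0 N p q)) * weightHom L (universalVec μ ν N p) =
      weightHom L (vacuumVertex (C μ * X) (descendant q)) := by
    rw [← sum_gram_mul_universalVec hc h hdet, map_sum]
    refine Finset.sum_congr rfl fun p _ => ?_
    rw [(isSymm_gram hc h N).apply, map_mul]
  rw [← map_vacuumVertex, ← h1, Finset.sum_mul]
  refine Finset.sum_congr rfl fun p _ => ?_
  ring

/-- The logarithm of the vacuum block, with coefficients in the polynomials in `ε = h / μ`. -/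
noncomputable def universalLog (μ ν : L) : L[X]⟦X⟧ :=
  PowerSeries.logOf (PowerSeries.mk (universalCoeff μ ν))

end Universal
-- Order in `h`, and integrality, of the logarithm of the block.
section LogIdeal

open PowerSeries

variable {A : Type*} [CommRing A] [Algebra ℚ A]

theorem logOf_one : logOf (1 : A⟦X⟧) = 0 := by
  refine eq_zero_of_derivative_eq_mul (H := 0) ?_ (constantCoeff_logOf (map_one _))
  rw [zero_mul, ← one_mul (d⁄dX A (logOf 1)), mul_derivative_logOf (map_one _), derivative_one]

theorem coeff_logOf_mem (I : Ideal A) {F : A⟦X⟧} (h0 : constantCoeff F = 1)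
    (hF : ∀ n, n ≠ 0 → coeff n F ∈ I) (n : ℕ) : coeff n (logOf F) ∈ I := by
  have h1 : map (Ideal.Quotient.mk I) F = 1 := by
    ext n
    rw [coeff_map, coeff_one]
    split_ifs with hn
    · rw [hn, coeff_zero_eq_constantCoeff_apply, h0, map_one]
    · exact Ideal.Quotient.eq_zero_iff_mem.2 (hF n hn)
  rw [← Ideal.Quotient.eq_zero_iff_mem, ← coeff_map, map_logOf _ h0, h1, logOf_one, map_zero]

end LogIdeal

section Universal

open Polynomial

variable {L : Type*} [Field L] [CharZero L] {c μ ν : L}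

theorem universalCoeff_zero (hc : c = 1 - 24 * μ) (h : 4 * μ * ν = 1)
    (hdet : ∀ N, (fockPairing μ ν N).det ≠ 0) : universalCoeff μ ν 0 = 1 := by
  apply weightHom_injective
  rw [weightHom_universalCoeff hc h hdet, whittaker_zero (four_mul_scalarHom h)
    (isUnit_det_fockPairing hdet) (scalarHom_contravariant hc h), map_one, map_one]

theorem coeff_zero_vacuumVertex (μ : L) {w : List ℕ} (hw : w ≠ []) :
    (vacuumVertex (C μ * X) w).coeff 0 = 0 := by
  induction w with
  | nil => exact absurd rfl hw
  | cons k w ih =>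
    rw [vacuumVertex, mul_coeff_zero]
    rcases eq_or_ne w [] with rfl | hw
    · simp
    · rw [ih hw, mul_zero]

theorem descendant_ne_nil {N : ℕ} (hN : N ≠ 0) (q : N.Partition) : descendant q ≠ [] := by
  intro h
  have := sum_descendant q
  rw [h] at this
  exact hN this.symm

/-- Expand `G v = ρ` in `ε`, with `G` constant and `ρ_0 = 0`. The constant term of `ρ · v` vanishes,
and its linear term is `ρ_1 · v_0 = v_1 · G v_0 = v_1 · ρ_0 = 0`. -/
theorem X_sq_dvd_universalCoeff (hc : c = 1 - 24 * μ) (h : 4 * μ * ν = 1)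
    (hdet : ∀ N, (fockPairing μ ν N).det ≠ 0) {N : ℕ} (hN : N ≠ 0) :
    X ^ 2 ∣ universalCoeff μ ν N := by
  have h0 : ∀ q : N.Partition, (vacuumVertex (C μ * X) (descendant q)).coeff 0 = 0 :=
    fun q => coeff_zero_vacuumVertex μ (descendant_ne_nil hN q)
  have hG : ∀ (k : ℕ) (p : N.Partition),
      ∑ q : N.Partition, gram c 0 N p q * (universalVec μ ν N q).coeff k =
        (vacuumVertex (C μ * X) (descendant p)).coeff k := fun k p => by
    rw [← sum_gram_mul_universalVec hc h hdet, finsetSum_coeff]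
    simp only [coeff_C_mul]
  rw [X_pow_dvd_iff]
  intro d hd
  rw [universalCoeff, finsetSum_coeff]
  interval_cases d
  · exact Finset.sum_eq_zero fun q _ => by rw [mul_coeff_zero, h0, zero_mul]
  · simp only [mul_coeff_one, h0, zero_mul, zero_add]
    simp only [← hG 1, Finset.sum_mul]
    rw [Finset.sum_comm]
    refine Finset.sum_eq_zero fun q _ => ?_
    have h1 := hG 0 q
    rw [h0] at h1
    have h2 := congrArg (fun x => x * (universalVec μ ν N q).coeff 1) h1
    simp only [zero_mul, Finset.sum_mul] at h2
    refine Eq.trans (Finset.sum_congr rfl fun p _ => ?_) h2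
    rw [(isSymm_gram hc h N).apply]
    ring

theorem coeff_coeff_universalLog_of_lt (hc : c = 1 - 24 * μ) (h : 4 * μ * ν = 1)
    (hdet : ∀ N, (fockPairing μ ν N).det ≠ 0) (N : ℕ) {k : ℕ} (hk : k < 2) :
    (PowerSeries.coeff N (universalLog μ ν)).coeff k = 0 := by
  have h1 := coeff_logOf_mem (Ideal.span {(X ^ 2 : L[X])})
    (F := PowerSeries.mk (universalCoeff μ ν))
    (by rw [← PowerSeries.coeff_zero_eq_constantCoeff_apply, PowerSeries.coeff_mk,
      universalCoeff_zero hc h hdet])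
    (fun n hn => by
      rw [PowerSeries.coeff_mk, Ideal.mem_span_singleton]
      exact X_sq_dvd_universalCoeff hc h hdet hn) N
  rw [Ideal.mem_span_singleton, X_pow_dvd_iff] at h1
  exact h1 k hk

/-- Polynomials with coefficients in a subalgebra. -/
def coeffSubalgebra (B : Subalgebra ℚ L) : Subalgebra ℚ L[X] where
  carrier := {p | ∀ k, p.coeff k ∈ B}
  mul_mem' {p q} hp hq k := by
    rw [coeff_mul]
    exact sum_mem fun x _ => mul_mem (hp _) (hq _)
  add_mem' {p q} hp hq k := by
    rw [coeff_add]
    exact add_mem (hp _) (hq _)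
  algebraMap_mem' r k := by
    rw [IsScalarTower.algebraMap_apply ℚ L L[X], algebraMap_eq, coeff_C]
    split_ifs
    · exact B.algebraMap_mem r
    · exact zero_mem B

theorem X_mem_coeffSubalgebra (B : Subalgebra ℚ L) : (X : L[X]) ∈ coeffSubalgebra B := fun k => by
  rw [coeff_X]
  split_ifs
  exacts [one_mem B, zero_mem B]

theorem C_mem_coeffSubalgebra {B : Subalgebra ℚ L} {a : L} (ha : a ∈ B) :
    C a ∈ coeffSubalgebra B := fun k => by
  rw [coeff_C]
  split_ifs
  exacts [ha, zero_mem B]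

/-- Elements of `WeightExt L` with coefficients in a subalgebra. -/
def weightSubalgebra (B : Subalgebra ℚ L) : Subalgebra ℚ (WeightExt L) where
  carrier := {z | z.re ∈ coeffSubalgebra B ∧ z.im ∈ coeffSubalgebra B}
  mul_mem' {z w} hz hw := by
    refine ⟨?_, ?_⟩
    · rw [QuadraticAlgebra.re_mul]
      exact add_mem (mul_mem hz.1 hw.1) (mul_mem (mul_mem (X_mem_coeffSubalgebra B) hz.2) hw.2)
    · rw [QuadraticAlgebra.im_mul]
      exact add_mem (add_mem (mul_mem hz.1 hw.2) (mul_mem hz.2 hw.1))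
        (mul_mem (mul_mem (neg_mem (ofNat_mem (coeffSubalgebra B) 2)) hz.2) hw.2)
  add_mem' {z w} hz hw := ⟨add_mem hz.1 hw.1, add_mem hz.2 hw.2⟩
  algebraMap_mem' r := by
    have : algebraMap ℚ (WeightExt L) r = weightHom L (algebraMap ℚ L[X] r) := by
      rw [RingHom.map_rat_algebraMap]
    rw [this]
    exact ⟨(coeffSubalgebra B).algebraMap_mem r, zero_mem _⟩

theorem weightHom_mem {B : Subalgebra ℚ L} {p : L[X]} (hp : p ∈ coeffSubalgebra B) :
    weightHom L p ∈ weightSubalgebra B := ⟨hp, zero_mem _⟩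

theorem weightRoot_mem (B : Subalgebra ℚ L) : weightRoot L ∈ weightSubalgebra B :=
  ⟨zero_mem _, one_mem _⟩

theorem exists_pow_mul_mem_coeffSubalgebra {B : Subalgebra ℚ L} (hν : ν ∈ B)
    (hden : ∀ r : L, ∃ n : ℕ, ν ^ n * r ∈ B) (p : L[X]) :
    ∃ n : ℕ, C ν ^ n * p ∈ coeffSubalgebra B := by
  induction p using Polynomial.induction_on' with
  | monomial k a =>
    obtain ⟨n, hn⟩ := hden a
    refine ⟨n, ?_⟩
    rw [← C_pow, C_mul_monomial, ← C_mul_X_pow_eq_monomial]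
    exact mul_mem (C_mem_coeffSubalgebra hn) (pow_mem (X_mem_coeffSubalgebra B) k)
  | add p q hp hq =>
    obtain ⟨m, hm⟩ := hp
    obtain ⟨n, hn⟩ := hq
    refine ⟨m + n, ?_⟩
    rw [show C ν ^ (m + n) * (p + q) = C ν ^ n * (C ν ^ m * p) + C ν ^ m * (C ν ^ n * q) by ring]
    exact add_mem (mul_mem (pow_mem (C_mem_coeffSubalgebra hν) _) hm)
      (mul_mem (pow_mem (C_mem_coeffSubalgebra hν) _) hn)

theorem exists_pow_mul_mem_weightSubalgebra {B : Subalgebra ℚ L} (hν : ν ∈ B)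
    (hden : ∀ r : L, ∃ n : ℕ, ν ^ n * r ∈ B) (z : WeightExt L) :
    ∃ n : ℕ, scalarHom L ν ^ n * z ∈ weightSubalgebra B := by
  obtain ⟨m, hm⟩ := exists_pow_mul_mem_coeffSubalgebra hν hden z.re
  obtain ⟨n, hn⟩ := exists_pow_mul_mem_coeffSubalgebra hν hden z.im
  have hz : z = weightHom L z.re + weightRoot L * weightHom L z.im := by
    ext1 <;> simp [weightRoot]
  refine ⟨m + n, ?_⟩
  have h1 : scalarHom L ν ^ (m + n) * z = weightHom L (C ν ^ n * (C ν ^ m * z.re)) +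
      weightRoot L * weightHom L (C ν ^ m * (C ν ^ n * z.im)) := by
    conv_lhs => rw [hz]
    simp only [map_mul, map_pow, scalarHom, RingHom.comp_apply]
    ring
  rw [h1]
  exact add_mem (weightHom_mem (mul_mem (pow_mem (C_mem_coeffSubalgebra hν) _) hm))
    (mul_mem (weightRoot_mem B)
      (weightHom_mem (mul_mem (pow_mem (C_mem_coeffSubalgebra hν) _) hn)))

/-- Exponentiation of the vacuum block: its logarithm is `μ` times an integral polynomial in
`ε = h / μ`. -/
theorem four_mul_coeff_universalLog_mem (hc : c = 1 - 24 * μ) (h : 4 * μ * ν = 1)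
    (hdet : ∀ N, (fockPairing μ ν N).det ≠ 0) {B : Subalgebra ℚ L} (hν : ν ∈ B)
    (hden : ∀ r : L, ∃ n : ℕ, ν ^ n * r ∈ B) (N k : ℕ) :
    4 * ν * (PowerSeries.coeff N (universalLog μ ν)).coeff k ∈ B := by
  set μ' := scalarHom L μ
  set ν' := scalarHom L ν
  set s := weightRoot L
  have hW := isWhittaker_whittaker (four_mul_scalarHom h) (isUnit_det_fockPairing hdet)
    (scalarHom_contravariant hc h) s
  have hs : s ∈ weightSubalgebra B := weightRoot_mem B
  have h1 := eval_mem_of_mem_polySubalgebra hs (hW.smul_log_mem (four_mul_scalarHom h)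
    (weightHom_mem (C_mem_coeffSubalgebra hν))
    (add_mem (pow_mem hs 2) (mul_mem (ofNat_mem _ 2) hs))
    (exists_pow_mul_mem_weightSubalgebra hν hden) N)
  -- The inclusion of polynomials in `ε` and evaluation at `s` are ring homomorphisms, so both
  -- commute with the logarithm; integrality of `log W` thereby passes to `log F`.
  have h2 : PowerSeries.map (weightHom L) (PowerSeries.mk (universalCoeff μ ν)) =
      PowerSeries.map (MvPolynomial.eval fun _ => s) (PowerSeries.mk (whittaker μ' ν' s)) := by
    ext1 n
    rw [PowerSeries.coeff_map, PowerSeries.coeff_map, PowerSeries.coeff_mk, PowerSeries.coeff_mk,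
      weightHom_universalCoeff hc h hdet]
  have h3 : MvPolynomial.eval (fun _ => s)
      (PowerSeries.coeff N (PowerSeries.logOf (PowerSeries.mk (whittaker μ' ν' s)))) =
      weightHom L (PowerSeries.coeff N (universalLog μ ν)) := by
    rw [← PowerSeries.coeff_map, map_logOf _ hW.constantCoeff_eq, ← h2, ← map_logOf,
      PowerSeries.coeff_map, universalLog]
    rw [← PowerSeries.coeff_zero_eq_constantCoeff_apply, PowerSeries.coeff_mk,
      universalCoeff_zero hc h hdet]
  rw [MvPolynomial.smul_eq_C_mul, map_mul, MvPolynomial.eval_C, h3] at h1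
  have h4 : 4 * ν' * weightHom L (PowerSeries.coeff N (universalLog μ ν)) =
      weightHom L (C (4 * ν) * PowerSeries.coeff N (universalLog μ ν)) := by
    rw [map_mul, map_mul, map_mul, map_ofNat, map_ofNat]
    rfl
  rw [h4] at h1
  have h5 := h1.1 k
  rwa [re_weightHom, coeff_C_mul] at h5

end Universal
-- Specialization to a given weight: `ε` becomes `4 ν h`.
section Specialization

open Polynomial

variable {L K : Type*} [Field L] [CharZero L] [Field K] {c μ ν : L}

theorem block_eq_map_universalCoeff (hc : c = 1 - 24 * μ) (h : 4 * μ * ν = 1)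
    (hdet : ∀ N, (fockPairing μ ν N).det ≠ 0) (σ : L →+* K) (x : K) :
    block x 0 (σ c) = PowerSeries.map (eval₂RingHom σ (x * σ (4 * ν)))
      (PowerSeries.mk (universalCoeff μ ν)) := by
  set g := eval₂RingHom σ (x * σ (4 * ν)) with hg
  have hx : g (C μ * X) = x := by
    rw [hg, coe_eval₂RingHom, eval₂_mul, eval₂_C, eval₂_X, mul_left_comm, ← map_mul,
      mul_left_comm, ← mul_assoc, h, map_one, mul_one]
  have hgram : ∀ N p q, gram (σ c) 0 N p q = g (C (gram c 0 N p q)) := fun N p q => by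
    rw [hg, coe_eval₂RingHom, eval₂_C, gram_apply, gram_apply, map_matrixElement, map_zero]
  have hvert : ∀ w, vertex x 0 w = g (vacuumVertex (C μ * X) w) := fun w => by
    rw [map_vacuumVertex, hx, vacuumVertex_eq_vertex]
  ext N
  rw [block, PowerSeries.coeff_map, PowerSeries.coeff_mk, PowerSeries.coeff_mk,
    blockCoeff_eq_dotProduct (v := fun q => g (universalVec μ ν N q)), universalCoeff, map_sum]
  · refine Finset.sum_congr rfl fun q _ => ?_
    exact (congrArg (· * _) (hvert _)).trans (map_mul g _ _).symm
  · ext p q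
    rw [Matrix.transpose_apply, hgram, hgram, (isSymm_gram hc h N).apply]
  · ext p
    rw [Matrix.mulVec, dotProduct, hvert, ← sum_gram_mul_universalVec hc h hdet, map_sum]
    refine Finset.sum_congr rfl fun q _ => ?_
    exact (congrArg (· * _) (hgram N p q)).trans (map_mul g _ _).symm

theorem logBlock_eq_map_universalLog [Algebra ℚ K] (hc : c = 1 - 24 * μ) (h : 4 * μ * ν = 1)
    (hdet : ∀ N, (fockPairing μ ν N).det ≠ 0) (σ : L →+* K) (x : K) :
    logBlock x 0 (σ c) =
      PowerSeries.map (eval₂RingHom σ (x * σ (4 * ν))) (universalLog μ ν) := by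
  rw [logBlock, block_eq_map_universalCoeff hc h hdet, universalLog, map_logOf]
  rw [← PowerSeries.coeff_zero_eq_constantCoeff_apply, PowerSeries.coeff_mk,
    universalCoeff_zero hc h hdet]

end Specialization

/-! ### Expansion at large central charge. -/

section LargeCharge

open HahnSeries

/-- The inclusion of the formal power series in `c⁻¹` into the Laurent series. -/
noncomputable abbrev integralHom : ℂ⟦X⟧ →+* LaurentSeries ℂ := ofPowerSeries ℤ ℂ

instance : CharZero (LaurentSeries ℂ) :=
  ⟨fun m n h => by
    have h1 : ((m : ℂ⟦X⟧) : ℂ⟦X⟧) = n := ofPowerSeries_injective (Γ := ℤ) (by simpa using h)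
    simpa using congrArg PowerSeries.constantCoeff h1⟩

/-- The central charge as a Laurent series in `c⁻¹`. -/
noncomputable def charge : LaurentSeries ℂ := single (-1) 1

/-- The level `(1 - c) / 24` of the background charge. -/
noncomputable def chargeLevel : LaurentSeries ℂ := (1 - charge) / 24

/-- The power series `6 / (1 - c)` in `c⁻¹`. -/
noncomputable def couplingSeries : ℂ⟦X⟧ := PowerSeries.X * (6 * (PowerSeries.X - 1)⁻¹)

theorem charge_eq : charge = 1 - 24 * chargeLevel := by
  rw [chargeLevel, mul_div_cancel₀ _ (by norm_num), sub_sub_cancel]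

theorem charge_mul_X : charge * integralHom PowerSeries.X = 1 := by
  rw [charge, integralHom, ofPowerSeries_X, single_mul_single]
  simp

theorem X_sub_one_mul_inv : (PowerSeries.X - 1 : ℂ⟦X⟧) * (PowerSeries.X - 1)⁻¹ = 1 :=
  PowerSeries.mul_inv_cancel _ (by simp)

theorem four_mul_chargeLevel : 4 * chargeLevel * integralHom couplingSeries = 1 := by
  have h1 := congrArg integralHom X_sub_one_mul_inv
  rw [map_mul, map_sub, map_one] at h1
  have h2 : 24 * chargeLevel = 1 - charge := by rw [charge_eq, sub_sub_cancel]
  rw [couplingSeries, map_mul, map_mul, map_ofNat]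
  linear_combination (integralHom PowerSeries.X * integralHom (PowerSeries.X - 1)⁻¹) * h2 -
    integralHom (PowerSeries.X - 1)⁻¹ * charge_mul_X + h1

theorem det_fockPairing_chargeLevel_ne_zero (N : ℕ) :
    (fockPairing chargeLevel (integralHom couplingSeries) N).det ≠ 0 :=
  det_fockPairing_ne_zero PowerSeries.constantCoeff integralHom ofPowerSeries_injective
    chargeLevel couplingSeries (by simp [couplingSeries]) N

/-- The Laurent series in `c⁻¹` without positive powers of `c`. -/
noncomputable def integralSubalgebra : Subalgebra ℚ (LaurentSeries ℂ) where
  toSubsemiring := integralHom.rangeS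
  algebraMap_mem' r := ⟨algebraMap ℚ _ r, RingHom.map_rat_algebraMap integralHom r⟩

theorem exists_X_pow_mul_mem_integralSubalgebra (x : LaurentSeries ℂ) :
    ∃ n : ℕ, integralHom PowerSeries.X ^ n * x ∈ integralSubalgebra := by
  obtain ⟨⟨f, s⟩, h⟩ := IsLocalization.surj (Submonoid.powers (PowerSeries.X : ℂ⟦X⟧)) x
  obtain ⟨n, hn⟩ := s.2
  refine ⟨n, f, ?_⟩
  rw [← map_pow]
  simp only [← hn] at h
  rw [mul_comm]
  exact h.symm

theorem exists_coupling_pow_mul_mem_integralSubalgebra (x : LaurentSeries ℂ) :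
    ∃ n : ℕ, integralHom couplingSeries ^ n * x ∈ integralSubalgebra := by
  obtain ⟨n, f, hf⟩ := exists_X_pow_mul_mem_integralSubalgebra x
  refine ⟨n, (6 * (PowerSeries.X - 1)⁻¹) ^ n * f, ?_⟩
  rw [couplingSeries, map_mul, hf, map_pow, map_mul integralHom PowerSeries.X, mul_pow]
  ring

/-- The inclusion of the Laurent series in `c⁻¹` into the Puiseux series. -/
noncomputable def puiseuxHom : LaurentSeries ℂ →+* PuiseuxAtInfty :=
  embDomainRingHom (Int.castAddHom ℚ) Int.cast_injective fun _ _ => Int.cast_le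

theorem puiseuxHom_charge : puiseuxHom charge = cPow 1 := by
  rw [charge, cPow]
  refine embDomain_single.trans ?_
  simp

theorem coeff_puiseuxHom_ne_zero {x : LaurentSeries ℂ} {e : ℚ} (h : (puiseuxHom x).coeff e ≠ 0) :
    ∃ j : ℤ, e = j ∧ x.coeff j ≠ 0 := by
  by_cases he : ∃ j : ℤ, (j : ℚ) = e
  · obtain ⟨j, rfl⟩ := he
    refine ⟨j, rfl, fun h0 => h ?_⟩
    rw [← h0]
    exact embDomain_coeff (f := ⟨⟨Int.castAddHom ℚ, Int.cast_injective⟩, Int.cast_le⟩) (a := j)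
  · exact absurd (embDomain_of_notMem_range
      (f := ⟨⟨Int.castAddHom ℚ, Int.cast_injective⟩, Int.cast_le⟩) he) h

theorem coeff_integralHom_X_pow_mul_ne_zero {f : ℂ⟦X⟧} {n : ℕ} {j : ℤ}
    (h : (integralHom (PowerSeries.X ^ n * f)).coeff j ≠ 0) : (n : ℤ) ≤ j := by
  rw [map_mul, integralHom, ofPowerSeries_X_pow, coeff_single_mul, one_mul,
    PowerSeries.coeff_coe] at h
  split_ifs at h with h1
  · exact absurd rfl h
  · simpa using h1

/-- The coefficient of `c⁻ᵉ` in the coefficient of `hᵏ` of the logarithmic vacuum block. -/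
noncomputable def logCoeff (N k : ℕ) (e : ℚ) : ℂ :=
  (puiseuxHom ((PowerSeries.coeff N (universalLog chargeLevel (integralHom couplingSeries))).coeff k
    * (4 * integralHom couplingSeries) ^ k)).coeff e

/-- Exponentiation in terms of exponents: the only monomials are `h ^ k c ^ (-j)` with `k ≥ 2` and
`j ≥ k - 1`. -/
theorem logCoeff_ne_zero {N k : ℕ} {e : ℚ} (h : logCoeff N k e ≠ 0) :
    2 ≤ k ∧ ∃ j : ℤ, e = j ∧ (k : ℤ) - 1 ≤ j := by
  obtain ⟨j, rfl, hj⟩ := coeff_puiseuxHom_ne_zero h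
  have hk : 2 ≤ k := by
    by_contra hk
    rw [coeff_coeff_universalLog_of_lt charge_eq four_mul_chargeLevel
      det_fockPairing_chargeLevel_ne_zero N (by omega), zero_mul] at hj
    exact hj rfl
  refine ⟨hk, j, rfl, ?_⟩
  obtain ⟨k, rfl⟩ : ∃ i, k = i + 1 := ⟨k - 1, by omega⟩
  obtain ⟨f, hf⟩ := four_mul_coeff_universalLog_mem charge_eq four_mul_chargeLevel
    det_fockPairing_chargeLevel_ne_zero (B := integralSubalgebra) ⟨_, rfl⟩
    exists_coupling_pow_mul_mem_integralSubalgebra N (k + 1)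
  -- Of the `k + 1` factors `4 ν` from `ε = 4 ν h`, one makes the coefficient integral and each of
  -- the others supplies a factor `c⁻¹`.
  have h1 : integralHom (PowerSeries.X ^ k * ((24 * (PowerSeries.X - 1)⁻¹) ^ k * f)) =
      (PowerSeries.coeff N (universalLog chargeLevel (integralHom couplingSeries))).coeff (k + 1)
        * (4 * integralHom couplingSeries) ^ (k + 1) := by
    rw [map_mul, map_mul, hf, map_pow, map_pow, map_mul, map_ofNat]
    rw [pow_succ (4 * _), couplingSeries, map_mul, map_mul, map_ofNat]
    ring
  rw [← h1] at hj
  have := coeff_integralHom_X_pow_mul_ne_zero hj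
  push_cast
  omega

/-- A bound for the powers of `h` in the coefficient of `z ^ N` of the logarithmic vacuum block. -/
noncomputable def weightBound (N : ℕ) : ℕ :=
  (PowerSeries.coeff N (universalLog chargeLevel (integralHom couplingSeries))).natDegree + 1

theorem logCoeff_of_weightBound_le {N k : ℕ} (h : weightBound N ≤ k) (e : ℚ) :
    logCoeff N k e = 0 := by
  rw [logCoeff, Polynomial.coeff_eq_zero_of_natDegree_lt h, zero_mul, map_zero, coeff_zero]

theorem coeff_vacuumCoeff (α b : ℚ) (δ : ℂ) (N : ℕ) : PowerSeries.coeff N (vacuumCoeff α b δ) =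
    ∑ k ∈ Finset.range (weightBound N), δ ^ k * logCoeff N k (k * α - b) := by
  rw [vacuumCoeff, PowerSeries.coeff_mk, heavyVacuumLogBlock, ← puiseuxHom_charge,
    logBlock_eq_map_universalLog charge_eq four_mul_chargeLevel
      det_fockPairing_chargeLevel_ne_zero, PowerSeries.coeff_map, Polynomial.coe_eval₂RingHom,
    Polynomial.eval₂_eq_sum_range, coeff_sum]
  refine Finset.sum_congr rfl fun k _ => ?_
  have h1 : HahnSeries.C δ * cPow α = single (-α) δ := by
    rw [cPow, HahnSeries.C_apply, single_mul_single, zero_add, mul_one]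
  rw [mul_pow, mul_left_comm, ← map_pow, ← map_mul, h1, single_pow, coeff_single_mul, logCoeff]
  congr 2
  simp
  ring

end LargeCharge
-- Counting exponents.
section Representation

theorem coeff_vacuumCoeff_eq {α b : ℚ} {m : ℕ} (h : ∀ (k : ℕ) (j : ℤ), 2 ≤ k → (k : ℤ) - 1 ≤ j →
    (k : ℚ) * α - b = j → k = m) (δ : ℂ) (N : ℕ) :
    PowerSeries.coeff N (vacuumCoeff α b δ) = δ ^ m * logCoeff N m (m * α - b) := by
  rw [coeff_vacuumCoeff]
  refine Finset.sum_eq_single m (fun k _ hkm => ?_) fun hm => ?_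
  · by_contra h0
    obtain ⟨hk, j, hj, hkj⟩ := logCoeff_ne_zero (right_ne_zero_of_mul h0)
    exact hkm (h k j hk hkj hj)
  · rw [logCoeff_of_weightBound_le (by simpa using hm), mul_zero]

theorem vacuumCoeff_eq_zero {α b : ℚ} (h : ∀ (k : ℕ) (j : ℤ), 2 ≤ k → (k : ℤ) - 1 ≤ j →
    (k : ℚ) * α - b ≠ j) (δ : ℂ) : vacuumCoeff α b δ = 0 := by
  ext N
  rw [coeff_vacuumCoeff_eq (m := 0) (fun k j hk hkj hj => absurd hj (h k j hk hkj)), map_zero]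
  by_contra h0
  have := (logCoeff_ne_zero (right_ne_zero_of_mul h0)).1
  omega

/-- The leading coefficient of `hᵏ` in the logarithmic vacuum block at large central charge. -/
noncomputable def leadingCoeff (k : ℕ) : ℂ⟦X⟧ :=
  PowerSeries.mk fun N => logCoeff N k (k - 1)

theorem leadingCoeff_of_lt {k : ℕ} (hk : k < 2) : leadingCoeff k = 0 := by
  ext N
  rw [leadingCoeff, PowerSeries.coeff_mk, map_zero]
  by_contra h
  have := (logCoeff_ne_zero h).1
  omega

/-- The power `c ^ 0` requires `k M = j (M + 1)`. This excludes `j ≥ k`, so `j = k - 1`, and then `k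
= M + 1`. -/
theorem isolatedCoeff_eq {M : ℕ} (δ : ℂ) :
    isolatedCoeff M δ = δ ^ (M + 1) • leadingCoeff (M + 1) := by
  have hM : ((M : ℚ) + 1) ≠ 0 := by positivity
  ext N
  rw [isolatedCoeff, coeff_vacuumCoeff_eq (m := M + 1), PowerSeries.coeff_smul, leadingCoeff,
    PowerSeries.coeff_mk, smul_eq_mul]
  · congr 2
    push_cast
    field_simp
    ring
  · intro k j hk hkj hj
    have h1 : (k : ℤ) * M = j * (M + 1) := by
      have : (k : ℚ) * M = j * (M + 1) := by
        rw [← hj]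
        field_simp
        ring
      exact_mod_cast this
    have h2 : j < k := by
      by_contra h2
      nlinarith
    obtain rfl : j = k - 1 := by omega
    zify
    linarith

/-- The lower bound on `α` makes the exponent of `c` positive, so `α < 1` forces `j < k`, hence `j =
k - 1`. Distinct `k` then give distinct exponents `1 - k (1 - α)`. -/
theorem regularCoeff_succ_eq {M : ℕ} {α : ℚ} (h1 : (M : ℚ) / (M + 1) < α) (h2 : α < 1) (δ : ℂ) :
    regularCoeff (M + 1) α δ = δ ^ (M + 1) • leadingCoeff (M + 1) := by
  rw [div_lt_iff₀ (by positivity)] at h1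
  ext N
  rw [regularCoeff, coeff_vacuumCoeff_eq (m := M + 1), PowerSeries.coeff_smul, leadingCoeff,
    PowerSeries.coeff_mk, smul_eq_mul]
  · congr 2
    ring
  · intro k j hk hkj hj
    push_cast at hj
    have h3 : j < k := by
      have : (j : ℚ) < k := by
        have hk : (0 : ℚ) < k := by positivity
        nlinarith
      exact_mod_cast this
    obtain rfl : j = k - 1 := by omega
    have h4 : ((k : ℚ) - (M + 1)) * (1 - α) = 0 := by
      push_cast at hj
      linarith
    rcases mul_eq_zero.1 h4 with h4 | h4
    · have : (k : ℚ) = (M + 1 : ℕ) := by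
        push_cast
        linarith
      exact_mod_cast this
    · linarith

/-- A positive exponent must be `1 - k (1 - α)`, which decreases in `k`. It is nonpositive for `k ≥
M + 1` by the bound on `α`, and at least `M α - (M - 1)` for `k ≤ M`. -/
theorem vacuumCoeff_eq_zero_of_lt {M : ℕ} {α b : ℚ} (h : α * (M + 1) ≤ M) (hb : 0 < b)
    (hb' : b < M * α - (M - 1)) (δ : ℂ) : vacuumCoeff α b δ = 0 := by
  refine vacuumCoeff_eq_zero (fun k j hk hkj hj => ?_) δ
  have hM : (0 : ℚ) ≤ M := Nat.cast_nonneg M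
  have hα : α < 1 := by
    by_contra hα
    nlinarith
  have hkj' : (k : ℚ) - 1 ≤ j := by exact_mod_cast hkj
  have h3 : k < M + 1 := by
    by_contra h3
    have h3' : (M : ℚ) + 1 ≤ k := by exact_mod_cast not_lt.1 h3
    nlinarith
  have h4 : (k : ℚ) ≤ M := by exact_mod_cast Nat.lt_succ_iff.1 h3
  have h5 : j < k := by
    have : (j : ℚ) < k := by
      have hk : (0 : ℚ) < k := by positivity
      nlinarith
    exact_mod_cast this
  obtain rfl : j = k - 1 := by omega
  push_cast at hj
  nlinarith

theorem coeff_zamolodchikovVacuum (δ : ℂ) (N : ℕ) : PowerSeries.coeff N (zamolodchikovVacuum δ) =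
    ∑ k ∈ Finset.range (weightBound N), δ ^ k * PowerSeries.coeff N (leadingCoeff k) := by
  rw [zamolodchikovVacuum, coeff_vacuumCoeff]
  simp only [mul_one, leadingCoeff, PowerSeries.coeff_mk]

/-- At `α = 1` every `k` contributes its leading term to `c ^ 1`, finitely many for each power of
`z`. A reindexing may omit or include `k = 0, 1`, whose terms are zero. -/
theorem isFormalSum_zamolodchikovVacuum {ι : Type*} {u : ι → ℂ⟦X⟧} {κ : ι → ℕ}
    (hκ : Function.Injective κ) (hκ' : ∀ k, 2 ≤ k → k ∈ Set.range κ) {δ : ℂ}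
    (hu : ∀ i, u i = δ ^ κ i • leadingCoeff (κ i)) : IsFormalSum u (zamolodchikovVacuum δ) := by
  intro N
  set v : ℕ → ℂ := fun k => δ ^ k * PowerSeries.coeff N (leadingCoeff k) with hv
  have huv : (fun i => PowerSeries.coeff N (u i)) = fun i => v (κ i) := by
    funext i
    rw [hu, PowerSeries.coeff_smul, smul_eq_mul]
  have hs : Function.support v ⊆ Finset.range (weightBound N) := fun k hk => by
    by_contra h
    refine hk ?_
    rw [hv]
    dsimp only
    rw [leadingCoeff, PowerSeries.coeff_mk,
      logCoeff_of_weightBound_le (by simpa using h), mul_zero]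
  have hr : Function.support v ⊆ Set.range κ := fun k hk => by
    refine hκ' k ?_
    by_contra h
    refine hk ?_
    rw [hv]
    dsimp only
    rw [leadingCoeff_of_lt (by omega), map_zero, mul_zero]
  rw [huv]
  refine ⟨((Finset.finite_toSet _).subset hs).preimage hκ.injOn, ?_⟩
  rw [coeff_zamolodchikovVacuum, ← finsum_eq_sum_of_support_subset v hs]
  rw [← finsum_mem_range hκ, finsum_mem_def, Set.indicator_eq_self.2 hr]

end Representation
end VirasoroBlock

open VirasoroBlock
theorem mainTheorem6 :
    -- the Zamolodchikov vacuum block is the sum of the isolated coefficients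
    (∀ δ : ℂ, IsFormalSum (fun M : ℕ+ => isolatedCoeff M δ) (zamolodchikovVacuum δ)) ∧
    -- each isolated coefficient is of order `δ ^ (M + 1)`
    (∃ a : ℕ+ → ℂ⟦X⟧, ∀ (M : ℕ+) (δ : ℂ), isolatedCoeff M δ = δ ^ ((M : ℕ) + 1) • a M) ∧
    -- the representation through the blocks at `α_M ∈ ((M - 1) / M, 1)`
    (∀ α : ℕ+ → ℚ, (∀ M : ℕ+, α M ∈ Set.Ioo (((M : ℚ) - 1) / (M : ℚ)) 1) →
      ∀ δ : ℂ, IsFormalSum (fun M : ℕ+ => regularCoeff M (α M) δ) (zamolodchikovVacuum δ)) ∧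
    -- whose term with `M = 1` is zero
    (∀ α ∈ Set.Ioo (0 : ℚ) 1, ∀ δ : ℂ, regularCoeff 1 α δ = 0) ∧
    -- and whose other terms are the isolated coefficients
    (∀ (M : ℕ+) (α : ℚ), α ∈ Set.Ioo ((M : ℚ) / ((M : ℚ) + 1)) 1 → ∀ δ : ℂ,
      regularCoeff ((M : ℕ) + 1) α δ = isolatedCoeff M δ) ∧
    -- for `α ∈ ((M - 1) / M, M / (M + 1)]` the power `M α - (M - 1)` is the lowest positive one
    (∀ (M : ℕ+) (α : ℚ),
      α ∈ Set.Ioc (((M : ℚ) - 1) / (M : ℚ)) ((M : ℚ) / ((M : ℚ) + 1)) →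
      ∀ b : ℚ, 0 < b → b < (M : ℚ) * α - ((M : ℚ) - 1) → ∀ δ : ℂ, vacuumCoeff α b δ = 0) := by
  have hreg : ∀ (M : ℕ+) (α : ℚ), α ∈ Set.Ioo (((M : ℚ) - 1) / (M : ℚ)) 1 → ∀ δ : ℂ,
      regularCoeff M α δ = δ ^ (M : ℕ) • leadingCoeff M := fun M α hα δ => by
    obtain ⟨m, hm⟩ : ∃ m : ℕ, (M : ℕ) = m + 1 := ⟨M - 1, (Nat.succ_pred_eq_of_pos M.pos).symm⟩
    rw [hm] at hα ⊢
    refine regularCoeff_succ_eq ?_ hα.2 δ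
    simpa using hα.1
  refine ⟨fun δ => ?_, ⟨fun M => leadingCoeff (M + 1), fun M δ => isolatedCoeff_eq δ⟩,
    fun α hα δ => ?_, fun α hα δ => ?_, fun M α hα δ => ?_, fun M α hα b hb hb' δ => ?_⟩
  · refine isFormalSum_zamolodchikovVacuum (κ := fun M : ℕ+ => (M : ℕ) + 1)
      (fun M M' h => PNat.coe_injective (Nat.succ_injective h)) (fun k hk => ?_)
      fun M => isolatedCoeff_eq δ
    exact ⟨⟨k - 1, by omega⟩, Nat.sub_add_cancel (by omega)⟩
  -- Here the index is `k = M` itself; the extra index `k = 1` is harmless.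
  · exact isFormalSum_zamolodchikovVacuum PNat.coe_injective
      (fun k hk => ⟨⟨k, by omega⟩, rfl⟩) fun M => hreg M (α M) (hα M) δ
  · have h1 := hreg 1 α (by simpa using hα) δ
    rwa [PNat.one_coe, leadingCoeff_of_lt one_lt_two, smul_zero] at h1
  · rw [regularCoeff_succ_eq hα.1 hα.2, isolatedCoeff_eq]
  · exact vacuumCoeff_eq_zero_of_lt ((le_div_iff₀ (by positivity)).1 hα.2) hb hb' δ
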